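/- **Conventions.** Let $d\ge 1$. A *$d$-complex* $X$ is a (finite or infinite) simplicial complex, containing the empty cell, in which every cell is contained in a cell of dimension $d$, no cell has larger dimension, and the $(d-1)$-cells have bounded degrees; the degree $\deg\sigma$ of a $j$-cell $\sigma$ is the number of $(j+1)$-cells containing it. Two $(d-1)$-cells are adjacent if their union is a $d$-cell; $\mathrm{dist}$ denotes the resulting graph distance, and $X$ is *$(d-1)$-connected* if this adjacency graph is connected. Let $w(\sigma)=1/\deg\sigma$ if $\dim\sigma=d-1$ and $w(\sigma)=1$ otherwise. Let $\Omega^{k}_{L^2}$ be the Hilbert space of real antisymmetric functions $f$ on the oriented $k$-cells with $\|f\|^2=\sum_{\sigma\in X^k}w(\sigma)f(\sigma)^2<\infty$, where $X^k$ is the set of unoriented $k$-cells (there is no orientation for $k=-1,0$, and $\Omega^{-2}_{L^2}=0$). For $f\in\Omega^{k-1}_{L^2}$ and a form $g$ on $k$-cells put $$(\delta_k f)(\sigma)=\frac1{w(\sigma)}\sum_{i=0}^{k}(-1)^i\,w(\sigma\setminus\sigma_i)\,f(\sigma\setminus\sigma_i),\qquad (\partial_k g)(\sigma)=\sum_{v:\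 v\sigma\in X}g(v\sigma).$$ Let $B^{k}=\delta_k(\Omega^{k-1}_{L^2})\cap\Omega^k_{L^2}$, let $Z_k=(B^k)^{\perp}\subseteq\Omega^k_{L^2}$, and, when the $k$-cells have bounded degrees, let $\Delta_k^+=\partial_{k+1}\delta_{k+1}$, a bounded self-adjoint operator on $\Omega^k_{L^2}$ which maps $Z_k$ to itself. Write $\Delta^+=\Delta^+_{d-1}$, $\lambda(X)=\min\mathrm{Spec}\,\Delta^+|_{Z_{d-1}}$ and, when the $(d-2)$-degrees are bounded, $\lambda_{d-2}(X)=\min\mathrm{Spec}\,\Delta^+_{d-2}|_{Z_{d-2}}$. For a $(d-1)$-cell $\sigma$ of $X$ let $B_r(X,\sigma)$ be the subcomplex formed by the $(d-1)$-cells at distance at most $r$ from $\sigma$, all their faces, and the $d$-cells all of whose $(d-1)$-faces are at distance at most $r$ from $\sigma$. Let $\mathrm{dist}((X,\sigma),(X',\sigma'))$ be the infimum of $\frac1{r+1}$ over the $r\ge 0$ for which there is an isomorphism of complexes $B_r(X,\sigma)\cong B_r(X',\sigma')$ taking $\sigma$ to $\sigma'$. Write $X_n\to X$ if the $(d-1)$-degrees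 of the $X_n$ are bounded by a common constant and, for some choice of $(d-1)$-cells $\sigma_n$ of $X_n$ and $\sigma$ of $X$, $\mathrm{dist}((X_n,\sigma_n),(X,\sigma))\to 0$. **Theorem.** Let $X_n$ $(n\in\mathbb N)$ and $X$ be $(d-1)$-connected $d$-complexes with $X_n\to X$, and suppose that one of the following holds: 1. zero is not in $\mathrm{Spec}\,\Delta_X^+|_{Z_{d-1}}$ (i.e. $\lambda(X)\ne0$); 2. zero is a non-isolated point of $\mathrm{Spec}\,\Delta_X^+|_{Z_{d-1}}$; 3. the $(d-1)$-skeletons of the $X_n$ form a family of $(d-1)$-expanders, that is, the degrees of the $(d-2)$-cells of the $X_n$ are bounded by a common constant and there is $c>0$ with $\lambda_{d-2}(X_n)\ge c$ for all $n$. Then $$\liminf_{n\to\infty}\lambda(X_n)\le\lambda(X).$$ -/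

import Mathlib

open Filter Topology

/-- A uniform simplicial complex of dimension `d` with vertices in `V` whose `(d-1)`-cells have
globally bounded degrees. Cells of dimension `j` are the members of `cells` of cardinality `j + 1`;
the empty cell, of dimension `-1`, is included (so this is not Mathlib's `AbstractSimplicialComplex`,
whose faces are nonempty). Uniformity also says that the dimension is exactly `d`. -/
structure DComplex (V : Type*) (d : ℕ) where
  cells : Set (Finset V)
  empty_mem : ∅ ∈ cells
  down_closed : ∀ s ∈ cells, ∀ t, t ⊆ s → t ∈ cells
  uniform : ∀ s ∈ cells, ∃ t ∈ cells, s ⊆ t ∧ t.card = d + 1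
  bounded : ∃ K : ℕ, ∀ s ∈ cells, s.card = d →
    {t ∈ cells | s ⊆ t ∧ t.card = s.card + 1}.encard ≤ K

namespace DComplex

variable {V : Type*} {d : ℕ} (X : DComplex V d)

/-- The degree of a cell: the number of cells of one dimension more which contain it. -/
noncomputable def degree (s : Finset V) : ℕ∞ :=
  {t ∈ X.cells | s ⊆ t ∧ t.card = s.card + 1}.encard

/-- The degrees of the cells with `k` vertices (that is, of dimension `k - 1`) are at most `K`. -/
def DegreesLE (k K : ℕ) : Prop := ∀ s ∈ X.cells, s.card = k → X.degree s ≤ K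

/-- The degrees of the cells with `k` vertices are globally bounded. -/
def DegreesBounded (k : ℕ) : Prop := ∃ K : ℕ, X.DegreesLE k K

theorem degreesBounded : X.DegreesBounded d := X.bounded

/-- The weight of a cell: `1 / deg` in codimension one, and `1` in all other dimensions. -/
noncomputable def weight (s : Finset V) : ℝ :=
  if s.card = d then ((X.degree s).toNat : ℝ)⁻¹ else 1

/-- The set of entries of a tuple. -/
noncomputable def verts {k : ℕ} (t : Fin k → V) : Finset V := (Set.finite_range t).toFinset

/-- `t` is an ordering of the vertices of a cell with `k` vertices. -/
def IsOrdering {k : ℕ} (t : Fin k → V) : Prop := Function.Injective t ∧ verts t ∈ X.cells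

/-- Weight of the cell spanned by a tuple. -/
noncomputable def wt {k : ℕ} (t : Fin k → V) : ℝ := X.weight (verts t)

/-! ### Basic facts -/

theorem coe_verts {k : ℕ} (t : Fin k → V) : (verts t : Set V) = Set.range t := by
  simp [verts]

theorem card_verts {k : ℕ} {t : Fin k → V} (h : Function.Injective t) : (verts t).card = k := by
  have : ((verts t : Finset V) : Set V).ncard = k := by
    rw [coe_verts, Set.ncard_range_of_injective h]; simp
  rwa [Set.ncard_coe_finset] at this

theorem verts_comp {k : ℕ} (t : Fin k → V) (p : Equiv.Perm (Fin k)) :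
    verts (t ∘ p) = verts t := by
  apply Finset.coe_injective
  rw [coe_verts, coe_verts, p.surjective.range_comp]

theorem isOrdering_comp {k : ℕ} {t : Fin k → V} (p : Equiv.Perm (Fin k)) :
    X.IsOrdering (t ∘ p) ↔ X.IsOrdering t := by
  unfold IsOrdering
  rw [verts_comp, p.injective_comp]

theorem wt_comp {k : ℕ} (t : Fin k → V) (p : Equiv.Perm (Fin k)) : X.wt (t ∘ p) = X.wt t := by
  unfold wt; rw [verts_comp]

theorem IsOrdering.succAbove {k : ℕ} {t : Fin (k + 1) → V} (h : X.IsOrdering t)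
    (i : Fin (k + 1)) : X.IsOrdering (t ∘ i.succAbove) := by
  refine ⟨h.1.comp Fin.succAbove_right_injective, X.down_closed _ h.2 _ ?_⟩
  rw [← Finset.coe_subset, coe_verts, coe_verts]
  exact Set.range_comp_subset_range _ _

theorem degree_pos {s : Finset V} (hs : s ∈ X.cells) (hc : s.card = d) : 0 < X.degree s := by
  obtain ⟨t, ht, hst, htc⟩ := X.uniform s hs
  rw [degree, Set.encard_pos]
  exact ⟨t, ht, hst, by omega⟩

theorem exists_weight_bounds :
    ∃ C : ℝ, 1 ≤ C ∧ ∀ s ∈ X.cells, 0 < X.weight s ∧ X.weight s ≤ 1 ∧ (X.weight s)⁻¹ ≤ C := by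
  obtain ⟨K, hK⟩ := X.degreesBounded
  refine ⟨max 1 K, le_max_left _ _, fun s hs => ?_⟩
  unfold weight
  split_ifs with h
  · have h1 := hK s hs h
    have h2 := X.degree_pos hs h
    have hfin : X.degree s ≠ ⊤ := ne_top_of_le_ne_top (by simp) h1
    obtain ⟨m, hm⟩ := ENat.ne_top_iff_exists.mp hfin
    rw [← hm] at h1 h2 ⊢
    have h1' : m ≤ K := by exact_mod_cast h1
    have h2' : 0 < m := by exact_mod_cast h2
    have h2'' : (1 : ℝ) ≤ m := by exact_mod_cast h2'
    simp only [ENat.toNat_natCast, inv_inv]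
    refine ⟨by positivity, inv_le_one_of_one_le₀ h2'', le_max_of_le_right (by exact_mod_cast h1')⟩
  · simp

theorem wt_pos {k : ℕ} {t : Fin k → V} (h : X.IsOrdering t) : 0 < X.wt t :=
  (X.exists_weight_bounds.choose_spec.2 _ h.2).1

theorem wt_nonneg {k : ℕ} (t : Fin k → V) : 0 ≤ X.wt t := by
  unfold wt weight
  split_ifs <;> positivity

theorem wt_le_one {k : ℕ} {t : Fin k → V} (h : X.IsOrdering t) : X.wt t ≤ 1 :=
  (X.exists_weight_bounds.choose_spec.2 _ h.2).2.1

/-- The vertices extending `t` to a larger ordered cell are as many as the degree of the cell. -/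
theorem finite_cons {k K : ℕ} (hK : X.DegreesLE k K) (t : Fin k → V) :
    {v | X.IsOrdering (Fin.cons v t : Fin (k + 1) → V)}.encard ≤ K := by
  by_cases ht : X.IsOrdering t
  · refine le_trans ?_ (hK _ ht.2 (card_verts ht.1))
    refine Set.encard_le_encard_of_injOn (f := fun v => verts (Fin.cons v t : Fin (k + 1) → V))
      ?_ ?_
    · intro v hv
      refine ⟨hv.2, ?_, by rw [card_verts hv.1, card_verts ht.1]⟩
      rw [← Finset.coe_subset, coe_verts, coe_verts]
      rw [Fin.range_cons]
      exact Set.subset_insert _ _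
    · intro v hv w hw hvw
      have h := congrArg (fun s : Finset V => (s : Set V)) hvw
      simp only [coe_verts, Fin.range_cons] at h
      have hvt : v ∉ Set.range t := (Fin.cons_injective_iff.mp hv.1).1
      have : v ∈ insert w (Set.range t) := h ▸ Set.mem_insert _ _
      rcases this with h | h
      · exact h
      · exact absurd h hvt
  · have : {v | X.IsOrdering (Fin.cons v t : Fin (k + 1) → V)} = ∅ := by
      ext v
      simp only [Set.mem_ofPred_eq, Set.mem_empty_iff_false, iff_false]
      intro hv
      apply ht
      have := IsOrdering.succAbove X hv 0
      simpa [Function.comp_def] using this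
    rw [this]; simp

/-! ### Square-summable forms -/

/-- Square-summable forms on the cells with `k` vertices, as a space of functions on `k`-tuples.
An oriented cell is an ordering of its vertices up to even permutations, so an antisymmetric function
on oriented cells is a function on the orderings of cells (extended by zero to all other tuples)
which is multiplied by the sign of a permutation of the entries. -/
noncomputable def l2Forms (k : ℕ) : Submodule ℝ ((Fin k → V) → ℝ) where
  carrier := {f | (∀ t, ¬ X.IsOrdering t → f t = 0) ∧
    (∀ (p : Equiv.Perm (Fin k)) t, f (t ∘ p) = ((Equiv.Perm.sign p : ℤ) : ℝ) * f t) ∧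
    Summable fun t => X.wt t * f t ^ 2}
  zero_mem' := by simp [summable_zero]
  add_mem' := by
    rintro f g ⟨hf1, hf2, hf3⟩ ⟨hg1, hg2, hg3⟩
    refine ⟨fun t ht => by simp [hf1 t ht, hg1 t ht], fun p t => ?_, ?_⟩
    · simp only [Pi.add_apply, hf2, hg2]; ring
    · refine Summable.of_nonneg_of_le (fun t => mul_nonneg (X.wt_nonneg t) (sq_nonneg _))
        (fun t => ?_) ((hf3.add hg3).mul_left 2)
      have := mul_nonneg (X.wt_nonneg t) (sq_nonneg (f t - g t))
      simp only [Pi.add_apply]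
      nlinarith
  smul_mem' := by
    rintro c f ⟨hf1, hf2, hf3⟩
    refine ⟨fun t ht => by simp [hf1 t ht], fun p t => ?_, ?_⟩
    · simp only [Pi.smul_apply, smul_eq_mul, hf2]; ring
    · refine (hf3.mul_left (c ^ 2)).congr fun t => ?_
      simp only [Pi.smul_apply, smul_eq_mul]; ring

/-- The space of square-summable forms on the cells with `k` vertices, i.e. of dimension `k - 1`. -/
def L2Form (k : ℕ) : Type _ := X.l2Forms k

noncomputable instance (k : ℕ) : AddCommGroup (X.L2Form k) :=
  inferInstanceAs (AddCommGroup (X.l2Forms k))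

noncomputable instance (k : ℕ) : Module ℝ (X.L2Form k) :=
  inferInstanceAs (Module ℝ (X.l2Forms k))

variable {X}

/-- The function on tuples underlying a form. -/
def L2Form.val {k : ℕ} (f : X.L2Form k) : (Fin k → V) → ℝ := Subtype.val f

theorem L2Form.ext_val {k : ℕ} {f g : X.L2Form k} (h : f.val = g.val) : f = g := Subtype.ext h

@[simp] theorem L2Form.val_add {k : ℕ} (f g : X.L2Form k) : (f + g).val = f.val + g.val := rfl
@[simp] theorem L2Form.val_smul {k : ℕ} (c : ℝ) (f : X.L2Form k) : (c • f).val = c • f.val := rfl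
@[simp] theorem L2Form.val_zero {k : ℕ} : (0 : X.L2Form k).val = 0 := rfl

theorem L2Form.eq_zero {k : ℕ} (f : X.L2Form k) {t : Fin k → V} (h : ¬ X.IsOrdering t) :
    f.val t = 0 := f.2.1 t h

theorem L2Form.comp_perm {k : ℕ} (f : X.L2Form k) (p : Equiv.Perm (Fin k)) (t : Fin k → V) :
    f.val (t ∘ p) = ((Equiv.Perm.sign p : ℤ) : ℝ) * f.val t := f.2.2.1 p t

theorem L2Form.summable_sq {k : ℕ} (f : X.L2Form k) :
    Summable fun t => X.wt t * f.val t ^ 2 := f.2.2.2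

theorem L2Form.summable_mul {k : ℕ} (f g : X.L2Form k) :
    Summable fun t => X.wt t * (f.val t * g.val t) := by
  refine Summable.of_norm_bounded (f.summable_sq.add g.summable_sq) fun t => ?_
  have hw := X.wt_nonneg t
  rw [Real.norm_eq_abs, abs_le]
  constructor <;>
  nlinarith [mul_nonneg hw (sq_nonneg (f.val t - g.val t)),
    mul_nonneg hw (sq_nonneg (f.val t + g.val t)), mul_nonneg hw (sq_nonneg (f.val t)),
    mul_nonneg hw (sq_nonneg (g.val t))]

/-- The inner product `⟨f, g⟩ = ∑ w(σ) f(σ) g(σ)`, the sum being over unoriented cells: each cell with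
`k` vertices has `k!` orderings, on all of which `f g` takes the same value. -/
noncomputable instance (k : ℕ) : InnerProductSpace.Core ℝ (X.L2Form k) where
  inner f g := (k.factorial : ℝ)⁻¹ * ∑' t, X.wt t * (f.val t * g.val t)
  conj_inner_symm f g := by
    simp only [conj_trivial]
    congr 1
    exact tsum_congr fun t => by ring
  re_inner_nonneg f := by
    refine mul_nonneg (by positivity) (tsum_nonneg fun t => ?_)
    exact mul_nonneg (X.wt_nonneg t) (mul_self_nonneg _)
  add_left f g h := by
    rw [← mul_add, ← (f.summable_mul h).tsum_add (g.summable_mul h)]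
    congr 1
    exact tsum_congr fun t => by simp; ring
  smul_left f g c := by
    simp only [conj_trivial]
    rw [mul_left_comm c]
    congr 1
    rw [← tsum_mul_left]
    exact tsum_congr fun t => by
      simp only [L2Form.val_smul, Pi.smul_apply, smul_eq_mul]; ring
  definite f hf := by
    have h0 : (k.factorial : ℝ)⁻¹ ≠ 0 := by positivity
    have h1 : ∑' t, X.wt t * (f.val t * f.val t) = 0 := (mul_eq_zero.mp hf).resolve_left h0
    have h2 := (hasSum_zero_iff_of_nonneg
      (fun t => mul_nonneg (X.wt_nonneg t) (mul_self_nonneg (f.val t)))).mp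
      (h1 ▸ (f.summable_mul f).hasSum)
    apply L2Form.ext_val
    ext t
    by_cases ht : X.IsOrdering t
    · have h3 := congrFun h2 t
      simp only [Pi.zero_apply, mul_eq_zero, or_self] at h3
      exact h3.resolve_left (X.wt_pos ht).ne'
    · exact f.eq_zero ht

noncomputable instance (k : ℕ) : NormedAddCommGroup (X.L2Form k) :=
  InnerProductSpace.Core.toNormedAddCommGroup (𝕜 := ℝ)

noncomputable instance (k : ℕ) : InnerProductSpace ℝ (X.L2Form k) :=
  InnerProductSpace.ofCore inferInstance

theorem L2Form.inner_def {k : ℕ} (f g : X.L2Form k) :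
    inner ℝ f g = (k.factorial : ℝ)⁻¹ * ∑' t, X.wt t * (f.val t * g.val t) := rfl

theorem L2Form.norm_sq {k : ℕ} (f : X.L2Form k) :
    ‖f‖ ^ 2 = (k.factorial : ℝ)⁻¹ * ∑' t, X.wt t * f.val t ^ 2 := by
  rw [← real_inner_self_eq_norm_sq, L2Form.inner_def]
  congr 1
  exact tsum_congr fun t => by ring

variable (X)

/-! ### Boundary and coboundary -/

/-- The boundary: `(∂f)(σ)` is the sum of `f(vσ)` over the vertices `v` such that `vσ` is a cell. -/
noncomputable def bdFun {k : ℕ} (f : (Fin (k + 1) → V) → ℝ) (t : Fin k → V) : ℝ :=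
  ∑ᶠ v : V, f (Fin.cons v t)

open Classical in
/-- The coboundary: `(δf)(σ) = w(σ)⁻¹ ∑ᵢ (-1)ⁱ w(σ \ σᵢ) f(σ \ σᵢ)` for every ordered cell `σ`. -/
noncomputable def cobFun {k : ℕ} (f : (Fin k → V) → ℝ) (t : Fin (k + 1) → V) : ℝ :=
  if X.IsOrdering t then
    (X.wt t)⁻¹ * ∑ i : Fin (k + 1),
      (-1) ^ (i : ℕ) * (X.wt (t ∘ i.succAbove) * f (t ∘ i.succAbove))
  else 0


variable {X}

theorem L2Form.summable_plain_sq {k : ℕ} (f : X.L2Form k) : Summable fun t => f.val t ^ 2 := by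
  obtain ⟨C, hC1, hC⟩ := X.exists_weight_bounds
  refine Summable.of_nonneg_of_le (fun t => sq_nonneg _) (fun t => ?_) (f.summable_sq.mul_left C)
  by_cases ht : X.IsOrdering t
  · obtain ⟨h1, h2, h3⟩ := hC _ ht.2
    have h4 : 1 ≤ C * X.wt t := by
      have := mul_le_mul_of_nonneg_right h3 h1.le
      rwa [inv_mul_cancel₀ h1.ne'] at this
    nlinarith [sq_nonneg (f.val t)]
  · simp [f.eq_zero ht]

theorem L2Form.support_cons_finite {k K : ℕ} (hK : X.DegreesLE k K) (f : X.L2Form (k + 1))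
    (t : Fin k → V) : (Function.support fun v : V => f.val (Fin.cons v t)).Finite := by
  have h : {v | X.IsOrdering (Fin.cons v t : Fin (k + 1) → V)}.Finite :=
    Set.finite_of_encard_le_coe (X.finite_cons hK t)
  refine h.subset fun v hv => ?_
  by_contra h'
  exact hv (f.eq_zero h')

theorem sq_finsum_le {K : ℕ} {S : Set V} (hS : S.encard ≤ K) (g : V → ℝ)
    (hg : ∀ v, v ∉ S → g v = 0) : (∑ᶠ v, g v) ^ 2 ≤ K * ∑' v, g v ^ 2 := by
  have hfin : S.Finite := Set.finite_of_encard_le_coe hS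
  have hsub : Function.support g ⊆ (hfin.toFinset : Set V) := by
    intro v hv
    by_contra h'
    exact hv (hg v (by simpa using h'))
  rw [finsum_eq_sum_of_support_subset g hsub,
    tsum_eq_sum (s := hfin.toFinset) (fun v hv => by rw [hg v (by simpa using hv)]; simp)]
  have hcard : (hfin.toFinset.card : ℝ) ≤ K := by
    rw [hfin.encard_eq_coe_toFinset_card] at hS
    exact_mod_cast hS
  exact sq_sum_le_card_mul_sum_sq.trans
    (mul_le_mul_of_nonneg_right hcard (Finset.sum_nonneg fun _ _ => sq_nonneg _))

theorem summable_cons {k : ℕ} {g : (Fin (k + 1) → V) → ℝ} (hg : Summable g) :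
    Summable fun q : (Fin k → V) × V => g (Fin.cons q.2 q.1) :=
  ((Equiv.prodComm _ _).trans (Fin.consEquiv fun _ : Fin (k + 1) => V)).summable_iff.mpr hg

theorem tsum_cons {k : ℕ} {g : (Fin (k + 1) → V) → ℝ} (hg : Summable g) :
    ∑' t, ∑' v, g (Fin.cons v t) = ∑' t, g t := by
  rw [← (summable_cons hg).tsum_prod]
  exact ((Equiv.prodComm _ _).trans (Fin.consEquiv fun _ : Fin (k + 1) => V)).tsum_eq g

theorem bdFun_sq_le {k K : ℕ} (hK : X.DegreesLE k K) (f : X.L2Form (k + 1)) (t : Fin k → V) :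
    X.wt t * bdFun f.val t ^ 2 ≤ K * ∑' v, f.val (Fin.cons v t) ^ 2 := by
  by_cases ht : X.IsOrdering t
  · have h1 := sq_finsum_le (X.finite_cons hK t) (fun v => f.val (Fin.cons v t))
      (fun v hv => f.eq_zero hv)
    exact (mul_le_of_le_one_left (sq_nonneg _) (X.wt_le_one ht)).trans h1
  · have h0 : bdFun f.val t = 0 := by
      unfold bdFun
      rw [← finsum_zero (α := V)]
      refine finsum_congr fun v => f.eq_zero fun hv => ht ?_
      have := IsOrdering.succAbove X hv 0
      simpa [Function.comp_def] using this
    rw [h0]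
    have : 0 ≤ ∑' v, f.val (Fin.cons v t) ^ 2 := tsum_nonneg fun _ => sq_nonneg _
    simpa using by positivity

theorem bdFun_summable {k K : ℕ} (hK : X.DegreesLE k K) (f : X.L2Form (k + 1)) :
    Summable fun t : Fin k → V => X.wt t * bdFun f.val t ^ 2 := by
  refine Summable.of_nonneg_of_le (fun t => mul_nonneg (X.wt_nonneg t) (sq_nonneg _))
    (bdFun_sq_le hK f) (Summable.mul_left _ ?_)
  exact (summable_cons f.summable_plain_sq).prod

theorem bdFun_comp {k : ℕ} (f : X.L2Form (k + 1)) (p : Equiv.Perm (Fin k)) (t : Fin k → V) :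
    bdFun f.val (t ∘ p) = ((Equiv.Perm.sign p : ℤ) : ℝ) * bdFun f.val t := by
  unfold bdFun
  rw [← smul_eq_mul, smul_finsum]
  refine finsum_congr fun v => ?_
  have h := f.comp_perm (Equiv.Perm.decomposeFin.symm (0, p)) (Fin.cons v t)
  rw [Equiv.Perm.decomposeFin.symm_sign] at h
  simp only [if_true, one_mul] at h
  rw [smul_eq_mul, ← h]
  congr 1
  ext i
  refine Fin.cases ?_ (fun i => ?_) i <;> simp

/-- The boundary operator `∂` on square-summable forms, for bounded degrees. -/
noncomputable def boundaryLM (k : ℕ) (h : X.DegreesBounded k) : X.L2Form (k + 1) →ₗ[ℝ] X.L2Form k where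
  toFun f := ⟨bdFun f.val, by
    intro t ht
    unfold bdFun
    rw [← finsum_zero (α := V)]
    refine finsum_congr fun v => f.eq_zero fun hv => ht ?_
    have := IsOrdering.succAbove X hv 0
    simpa [Function.comp_def] using this, bdFun_comp f, bdFun_summable h.choose_spec f⟩
  map_add' f g := by
    apply L2Form.ext_val
    ext t
    exact finsum_add_distrib (f.support_cons_finite h.choose_spec t)
      (g.support_cons_finite h.choose_spec t)
  map_smul' c f := by
    apply L2Form.ext_val
    ext t
    exact (smul_finsum c _).symm

theorem boundaryLM_val {k : ℕ} (h : X.DegreesBounded k) (f : X.L2Form (k + 1)) :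
    (boundaryLM k h f).val = bdFun f.val := rfl

theorem exists_boundaryLM_bound (k : ℕ) (h : X.DegreesBounded k) :
    ∃ C, ∀ f : X.L2Form (k + 1), ‖boundaryLM k h f‖ ≤ C * ‖f‖ := by
  obtain ⟨K, hK⟩ := id h
  obtain ⟨C, hC1, hC⟩ := X.exists_weight_bounds
  have hC0 : 0 ≤ C := by linarith
  refine ⟨√((k + 1 : ℝ) * K * C), fun f => ?_⟩
  refine abs_le_of_sq_le_sq' ?_ (by positivity) |>.2
  rw [mul_pow, Real.sq_sqrt (by positivity), L2Form.norm_sq, L2Form.norm_sq, boundaryLM_val]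
  have h1 : ∑' t, X.wt t * bdFun f.val t ^ 2 ≤ K * ∑' t, f.val t ^ 2 := by
    rw [← tsum_cons f.summable_plain_sq, ← tsum_mul_left]
    exact (bdFun_summable hK f).tsum_le_tsum (bdFun_sq_le hK f)
      (Summable.mul_left _ (summable_cons f.summable_plain_sq).prod)
  have h2 : ∑' t, f.val t ^ 2 ≤ C * ∑' t, X.wt t * f.val t ^ 2 := by
    rw [← tsum_mul_left]
    refine f.summable_plain_sq.tsum_le_tsum (fun t => ?_) (f.summable_sq.mul_left C)
    by_cases ht : X.IsOrdering t
    · obtain ⟨h1, h2, h3⟩ := hC _ ht.2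
      have h4 : 1 ≤ C * X.wt t := by
        have := mul_le_mul_of_nonneg_right h3 h1.le
        rwa [inv_mul_cancel₀ h1.ne'] at this
      nlinarith [sq_nonneg (f.val t)]
    · simp [f.eq_zero ht]
  have h3 : ((k + 1).factorial : ℝ)⁻¹ * (k + 1) = (k.factorial : ℝ)⁻¹ := by
    rw [Nat.factorial_succ]; push_cast; field_simp
  rw [← h3]
  calc _ ≤ ((k + 1).factorial : ℝ)⁻¹ * (k + 1) * (K * (C * ∑' t, X.wt t * f.val t ^ 2)) := by
        gcongr
        exact h1.trans (by gcongr)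
    _ = _ := by ring

/-- The boundary operator `∂`, bounded when the cells with `k` vertices have bounded degrees. -/
noncomputable def boundary (k : ℕ) (h : X.DegreesBounded k) : X.L2Form (k + 1) →L[ℝ] X.L2Form k :=
  (boundaryLM k h).mkContinuousOfExistsBound (exists_boundaryLM_bound k h)

theorem boundary_val {k : ℕ} (h : X.DegreesBounded k) (f : X.L2Form (k + 1)) :
    (boundary k h f).val = bdFun f.val := rfl

theorem comp_cycleRange_symm_tail {k : ℕ} (t : Fin (k + 1) → V) (i : Fin (k + 1)) :
    Fin.tail (t ∘ i.cycleRange.symm) = t ∘ i.succAbove := by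
  ext j
  simp [Fin.tail, Fin.cycleRange_symm_succ]

/-- The coboundary written through the cyclic permutations moving each vertex to the front. -/
theorem cobFun_eq {k : ℕ} (f : (Fin k → V) → ℝ) {t : Fin (k + 1) → V} (ht : X.IsOrdering t) :
    X.cobFun f t = (X.wt t)⁻¹ * ∑ i : Fin (k + 1), ((Equiv.Perm.sign i.cycleRange : ℤ) : ℝ) *
      (X.wt (Fin.tail (t ∘ i.cycleRange.symm)) * f (Fin.tail (t ∘ i.cycleRange.symm))) := by
  unfold cobFun
  rw [if_pos ht]
  congr 1
  refine Finset.sum_congr rfl fun i _ => ?_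
  rw [comp_cycleRange_symm_tail, Fin.sign_cycleRange]
  push_cast
  rfl

theorem tail_comp_perm {k : ℕ} (f : X.L2Form k) (s : Fin (k + 1) → V)
    (r : Equiv.Perm (Fin (k + 1))) (hr : r 0 = 0) :
    X.wt (Fin.tail (s ∘ r)) * f.val (Fin.tail (s ∘ r)) =
      ((Equiv.Perm.sign r : ℤ) : ℝ) * (X.wt (Fin.tail s) * f.val (Fin.tail s)) := by
  obtain ⟨⟨p, e⟩, rfl⟩ := Equiv.Perm.decomposeFin.symm.surjective r
  have hp : p = 0 := by simpa using hr
  subst hp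
  have : Fin.tail (s ∘ Equiv.Perm.decomposeFin.symm (0, e)) = Fin.tail s ∘ e := by
    ext j
    simp [Fin.tail]
  rw [this, X.wt_comp, f.comp_perm, Equiv.Perm.decomposeFin.symm_sign]
  simp only [if_true, one_mul]
  ring

theorem cobFun_comp {k : ℕ} (f : X.L2Form k) (p : Equiv.Perm (Fin (k + 1)))
    (t : Fin (k + 1) → V) :
    X.cobFun f.val (t ∘ p) = ((Equiv.Perm.sign p : ℤ) : ℝ) * X.cobFun f.val t := by
  by_cases ht : X.IsOrdering t
  · rw [cobFun_eq _ ht, cobFun_eq _ ((X.isOrdering_comp p).mpr ht), X.wt_comp, mul_left_comm]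
    congr 1
    rw [Finset.mul_sum]
    refine Eq.trans ?_ (Equiv.sum_comp p _)
    refine Finset.sum_congr rfl fun i _ => ?_
    set r : Equiv.Perm (Fin (k + 1)) := i.cycleRange.symm.trans (p.trans (p i).cycleRange) with hr
    have hr0 : r 0 = 0 := by
      simp [hr, Fin.cycleRange_symm_zero]
    have h1 : (t ∘ p) ∘ i.cycleRange.symm = (t ∘ (p i).cycleRange.symm) ∘ r := by
      ext j
      simp [hr]
    have h2 : (Equiv.Perm.sign r : ℤ) =
        Equiv.Perm.sign (p i).cycleRange * (Equiv.Perm.sign p * Equiv.Perm.sign i.cycleRange) := by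
      rw [hr, Equiv.Perm.sign_trans, Equiv.Perm.sign_trans, Equiv.Perm.sign_symm]
      push_cast
      ring
    rw [h1, tail_comp_perm f _ r hr0, h2]
    have h3 : (((Equiv.Perm.sign i.cycleRange : ℤ) : ℝ)) *
        ((Equiv.Perm.sign i.cycleRange : ℤ) : ℝ) = 1 := by
      rw [← Int.cast_mul, ← Units.val_mul, Int.units_mul_self]; simp
    push_cast
    linear_combination (((Equiv.Perm.sign (p i).cycleRange : ℤ) : ℝ) *
      ((Equiv.Perm.sign p : ℤ) : ℝ) *
      (X.wt (Fin.tail (t ∘ (p i).cycleRange.symm)) *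
        f.val (Fin.tail (t ∘ (p i).cycleRange.symm)))) * h3
  · have ht' : ¬ X.IsOrdering (t ∘ p) := fun h => ht ((X.isOrdering_comp p).mp h)
    simp [cobFun, ht, ht']

theorem cobFun_add {k : ℕ} (f g : (Fin k → V) → ℝ) :
    X.cobFun (f + g) = X.cobFun f + X.cobFun g := by
  ext t
  simp only [cobFun, Pi.add_apply]
  split_ifs
  · rw [← mul_add, ← Finset.sum_add_distrib]
    congr 1
    exact Finset.sum_congr rfl fun i _ => by ring
  · simp

theorem cobFun_smul {k : ℕ} (c : ℝ) (f : (Fin k → V) → ℝ) :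
    X.cobFun (c • f) = c • X.cobFun f := by
  ext t
  simp only [cobFun, Pi.smul_apply, smul_eq_mul]
  split_ifs
  · rw [mul_left_comm c]
    congr 1
    rw [Finset.mul_sum]
    exact Finset.sum_congr rfl fun i _ => by ring
  · simp

open Classical in
/-- Auxiliary: the form `f`, squared and weighted, read on the tail of an ordered cell. -/
noncomputable def tailSq {k : ℕ} (f : X.L2Form k) (t : Fin (k + 1) → V) : ℝ :=
  if X.IsOrdering t then X.wt (Fin.tail t) * f.val (Fin.tail t) ^ 2 else 0

theorem tailSq_nonneg {k : ℕ} (f : X.L2Form k) (t : Fin (k + 1) → V) : 0 ≤ tailSq f t := by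
  unfold tailSq
  split_ifs
  · exact mul_nonneg (X.wt_nonneg _) (sq_nonneg _)
  · exact le_rfl

theorem tailSq_cons {k K : ℕ} (hK : X.DegreesLE k K) (f : X.L2Form k) (s : Fin k → V) :
    (Summable fun v => tailSq f (Fin.cons v s)) ∧
    ∑' v, tailSq f (Fin.cons v s) ≤ K * (X.wt s * f.val s ^ 2) := by
  have hS := X.finite_cons hK s
  have hfin : {v | X.IsOrdering (Fin.cons v s : Fin (k + 1) → V)}.Finite :=
    Set.finite_of_encard_le_coe hS
  have h0 : ∀ v ∉ hfin.toFinset, tailSq f (Fin.cons v s) = 0 := by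
    intro v hv
    have : ¬ X.IsOrdering (Fin.cons v s : Fin (k + 1) → V) := by simpa using hv
    simp [tailSq, this]
  refine ⟨summable_of_ne_finset_zero h0, ?_⟩
  rw [tsum_eq_sum h0]
  have hcard : (hfin.toFinset.card : ℝ) ≤ K := by
    rw [hfin.encard_eq_coe_toFinset_card] at hS
    exact_mod_cast hS
  have hn : 0 ≤ X.wt s * f.val s ^ 2 := mul_nonneg (X.wt_nonneg _) (sq_nonneg _)
  calc _ ≤ ∑ v ∈ hfin.toFinset, X.wt s * f.val s ^ 2 := by
        refine Finset.sum_le_sum fun v _ => ?_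
        unfold tailSq
        split_ifs
        · simp
        · exact hn
    _ = hfin.toFinset.card * (X.wt s * f.val s ^ 2) := by simp
    _ ≤ _ := mul_le_mul_of_nonneg_right hcard hn

theorem tailSq_summable {k K : ℕ} (hK : X.DegreesLE k K) (f : X.L2Form k) :
    Summable (tailSq f) ∧ ∑' t, tailSq f t ≤ K * ∑' s, X.wt s * f.val s ^ 2 := by
  have h1 : Summable fun s : Fin k → V => ∑' v, tailSq f (Fin.cons v s) :=
    Summable.of_nonneg_of_le (fun s => tsum_nonneg fun v => tailSq_nonneg f _)
      (fun s => (tailSq_cons hK f s).2) (f.summable_sq.mul_left _)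
  have h2 : Summable fun q : (Fin k → V) × V => tailSq f (Fin.cons q.2 q.1) :=
    (summable_prod_of_nonneg fun q => tailSq_nonneg f _).mpr
      ⟨fun s => (tailSq_cons hK f s).1, h1⟩
  have h3 : Summable (tailSq f) :=
    ((Equiv.prodComm _ _).trans (Fin.consEquiv fun _ : Fin (k + 1) => V)).summable_iff.mp h2
  refine ⟨h3, ?_⟩
  rw [← tsum_cons h3, ← tsum_mul_left]
  exact h1.tsum_le_tsum (fun s => (tailSq_cons hK f s).2) (f.summable_sq.mul_left _)

/-- Permuting the entries of tuples. -/
def permTuple {k : ℕ} (p : Equiv.Perm (Fin k)) : (Fin k → V) ≃ (Fin k → V) where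
  toFun t := t ∘ p
  invFun t := t ∘ p.symm
  left_inv t := by ext; simp
  right_inv t := by ext; simp

theorem summable_perm {k : ℕ} {g : (Fin k → V) → ℝ} (hg : Summable g)
    (p : Equiv.Perm (Fin k)) : Summable fun t => g (permTuple p t) :=
  (permTuple p).summable_iff.mpr hg

theorem tsum_perm {k : ℕ} (g : (Fin k → V) → ℝ) (p : Equiv.Perm (Fin k)) :
    ∑' t, g (permTuple p t) = ∑' t, g t :=
  (permTuple p).tsum_eq g

theorem exists_cobFun_sq_le : ∃ C : ℝ, 0 ≤ C ∧ ∀ (k : ℕ) (f : X.L2Form k) (t : Fin (k + 1) → V),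
    X.wt t * X.cobFun f.val t ^ 2 ≤
      C * (k + 1) * ∑ i : Fin (k + 1), tailSq f (permTuple i.cycleRange.symm t) := by
  obtain ⟨C, hC1, hC⟩ := X.exists_weight_bounds
  refine ⟨C, by linarith, fun k f t => ?_⟩
  by_cases ht : X.IsOrdering t
  · obtain ⟨h1, h2, h3⟩ := hC _ ht.2
    rw [cobFun_eq _ ht]
    set a : Fin (k + 1) → ℝ := fun i => ((Equiv.Perm.sign i.cycleRange : ℤ) : ℝ) *
      (X.wt (Fin.tail (t ∘ i.cycleRange.symm)) * f.val (Fin.tail (t ∘ i.cycleRange.symm)))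
      with ha
    have e1 : X.wt t * ((X.wt t)⁻¹ * ∑ i, a i) ^ 2 = (X.wt t)⁻¹ * (∑ i, a i) ^ 2 := by
      have : X.wt t ≠ 0 := h1.ne'
      field_simp
    have e2 : (∑ i, a i) ^ 2 ≤ (k + 1) * ∑ i, a i ^ 2 := by
      have := sq_sum_le_card_mul_sum_sq (s := (Finset.univ : Finset (Fin (k + 1)))) (f := a)
      simpa using this
    have e3 : ∀ i, a i ^ 2 ≤ tailSq f (permTuple i.cycleRange.symm t) := by
      intro i
      have hti : X.IsOrdering (t ∘ i.cycleRange.symm) := (X.isOrdering_comp _).mpr ht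
      have hw : X.IsOrdering (Fin.tail (t ∘ i.cycleRange.symm)) := by
        rw [comp_cycleRange_symm_tail]; exact IsOrdering.succAbove X ht i
      have hs : (((Equiv.Perm.sign i.cycleRange : ℤ) : ℝ)) ^ 2 = 1 := by
        rw [pow_two, ← Int.cast_mul, ← Units.val_mul, Int.units_mul_self]; simp
      have : tailSq f (permTuple i.cycleRange.symm t) =
          X.wt (Fin.tail (t ∘ i.cycleRange.symm)) *
            f.val (Fin.tail (t ∘ i.cycleRange.symm)) ^ 2 := by
        exact if_pos hti
      rw [this, ha]
      simp only [mul_pow, hs, one_mul]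
      refine mul_le_mul_of_nonneg_right ?_ (sq_nonneg _)
      rw [pow_two]
      exact mul_le_of_le_one_left (X.wt_nonneg _) (X.wt_le_one hw)
    rw [e1]
    have hn : 0 ≤ ∑ i, a i ^ 2 := Finset.sum_nonneg fun _ _ => sq_nonneg _
    calc _ ≤ C * ((k + 1) * ∑ i, a i ^ 2) :=
          mul_le_mul h3 e2 (sq_nonneg _) (by linarith)
      _ ≤ C * ((k + 1) * ∑ i : Fin (k + 1), tailSq f (permTuple i.cycleRange.symm t)) := by
          have : (0 : ℝ) ≤ C := by linarith
          gcongr with i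
          exact e3 i
      _ = _ := by ring
  · have : X.cobFun f.val t = 0 := by simp [cobFun, ht]
    rw [this]
    have h1 : (0 : ℝ) ≤ C := by linarith
    have h2 : 0 ≤ ∑ i : Fin (k + 1), tailSq f (permTuple i.cycleRange.symm t) :=
      Finset.sum_nonneg fun _ _ => tailSq_nonneg f _
    simpa using by positivity

theorem tailSq_perm_summable {k K : ℕ} (hK : X.DegreesLE k K) (f : X.L2Form k)
    (p : Equiv.Perm (Fin (k + 1))) : Summable fun t => tailSq f (permTuple p t) :=
  summable_perm (tailSq_summable hK f).1 p

theorem cobFun_summable {k K : ℕ} (hK : X.DegreesLE k K) (f : X.L2Form k) :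
    Summable fun t => X.wt t * X.cobFun f.val t ^ 2 := by
  obtain ⟨C, hC0, hC⟩ := X.exists_cobFun_sq_le
  refine Summable.of_nonneg_of_le (fun t => mul_nonneg (X.wt_nonneg t) (sq_nonneg _))
    (fun t => hC k f t) (Summable.mul_left _ ?_)
  exact summable_sum fun i _ => tailSq_perm_summable hK f _

/-- The coboundary operator `δ` on square-summable forms, for bounded degrees. -/
noncomputable def coboundaryLM (k : ℕ) (h : X.DegreesBounded k) :
    X.L2Form k →ₗ[ℝ] X.L2Form (k + 1) where
  toFun f := ⟨X.cobFun f.val, fun t ht => by simp [cobFun, ht], cobFun_comp f,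
    cobFun_summable h.choose_spec f⟩
  map_add' f g := L2Form.ext_val (cobFun_add f.val g.val)
  map_smul' c f := L2Form.ext_val (cobFun_smul c f.val)

theorem coboundaryLM_val {k : ℕ} (h : X.DegreesBounded k) (f : X.L2Form k) :
    (coboundaryLM k h f).val = X.cobFun f.val := rfl

theorem exists_coboundaryLM_bound (k : ℕ) (h : X.DegreesBounded k) :
    ∃ C, ∀ f : X.L2Form k, ‖coboundaryLM k h f‖ ≤ C * ‖f‖ := by
  obtain ⟨K, hK⟩ := id h
  obtain ⟨C, hC0, hC⟩ := X.exists_cobFun_sq_le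
  refine ⟨√((k + 1 : ℝ) * K * C), fun f => ?_⟩
  refine abs_le_of_sq_le_sq' ?_ (by positivity) |>.2
  rw [mul_pow, Real.sq_sqrt (by positivity), L2Form.norm_sq, L2Form.norm_sq, coboundaryLM_val]
  have h1 : ∑' t, X.wt t * X.cobFun f.val t ^ 2 ≤
      C * (k + 1) * ((k + 1) * ∑' t, tailSq f t) := by
    have e : ∑' t, ∑ i : Fin (k + 1), tailSq f (permTuple i.cycleRange.symm t) =
        (k + 1) * ∑' t, tailSq f t := by
      rw [Summable.tsum_finsetSum fun i _ => tailSq_perm_summable hK f _]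
      simp only [tsum_perm (tailSq f)]
      simp
    rw [← e, ← tsum_mul_left]
    exact (cobFun_summable hK f).tsum_le_tsum (fun t => hC k f t)
      (Summable.mul_left _ (summable_sum fun i _ => tailSq_perm_summable hK f _))
  have h3 : ((k + 1).factorial : ℝ)⁻¹ * (k + 1) = (k.factorial : ℝ)⁻¹ := by
    rw [Nat.factorial_succ]; push_cast; field_simp
  rw [← h3]
  calc _ ≤ ((k + 1).factorial : ℝ)⁻¹ * (C * (k + 1) * ((k + 1) *
          (K * ∑' t, X.wt t * f.val t ^ 2))) := by
        gcongr
        exact h1.trans (by gcongr; exact (tailSq_summable hK f).2)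
    _ = _ := by ring

/-- The coboundary operator `δ`, bounded when the cells with `k` vertices have bounded degrees. -/
noncomputable def coboundary (k : ℕ) (h : X.DegreesBounded k) :
    X.L2Form k →L[ℝ] X.L2Form (k + 1) :=
  (coboundaryLM k h).mkContinuousOfExistsBound (exists_coboundaryLM_bound k h)

theorem coboundary_val {k : ℕ} (h : X.DegreesBounded k) (f : X.L2Form k) :
    (coboundary k h f).val = X.cobFun f.val := rfl


/-! ### Adjointness, and the composition of coboundaries -/

theorem inner_boundary {k : ℕ} (h : X.DegreesBounded k) (f : X.L2Form (k + 1)) (g : X.L2Form k) :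
    inner ℝ (boundary k h f) g = inner ℝ f (coboundary k h g) := by
  obtain ⟨K, hK⟩ := id h
  set G : (Fin (k + 1) → V) → ℝ :=
    fun t => f.val t * (X.wt (Fin.tail t) * g.val (Fin.tail t)) with hG
  have hGsum : Summable G := by
    refine Summable.of_norm_bounded (f.summable_plain_sq.add (tailSq_summable hK g).1) fun t => ?_
    by_cases ht : X.IsOrdering t
    · have e : tailSq g t = X.wt (Fin.tail t) * g.val (Fin.tail t) ^ 2 := if_pos ht
      have htl : X.IsOrdering (Fin.tail t) := by
        have := IsOrdering.succAbove X ht 0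
        rwa [Fin.succAbove_zero] at this
      have hw0 := X.wt_nonneg (Fin.tail t)
      have hw1 := X.wt_le_one htl
      rw [e, hG, Real.norm_eq_abs, abs_le]
      set w := X.wt (Fin.tail t)
      set b := g.val (Fin.tail t)
      set a := f.val t
      have h2 : w ^ 2 * b ^ 2 ≤ w * b ^ 2 := by
        refine mul_le_mul_of_nonneg_right ?_ (sq_nonneg _)
        rw [pow_two]; exact mul_le_of_le_one_left hw0 hw1
      constructor <;> nlinarith [sq_nonneg (a + w * b), sq_nonneg (a - w * b),
        sq_nonneg a, sq_nonneg (w * b)]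
    · have : G t = 0 := by simp [hG, f.eq_zero ht]
      rw [this, norm_zero]
      exact add_nonneg (sq_nonneg _) (tailSq_nonneg _ _)
  have e1 : ∑' t, X.wt t * ((boundary k h f).val t * g.val t) = ∑' t, G t := by
    rw [← tsum_cons hGsum]
    refine tsum_congr fun s => ?_
    have hfin := f.support_cons_finite hK s
    rw [boundary_val, bdFun, finsum_eq_sum _ hfin, tsum_eq_sum (s := hfin.toFinset), Finset.sum_mul,
      Finset.mul_sum]
    · refine Finset.sum_congr rfl fun v _ => ?_
      simp only [hG, Fin.tail_cons]
      ring
    · intro v hv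
      have : f.val (Fin.cons v s) = 0 := by simpa using hv
      simp [hG, this]
  have e2 : ∑' t, X.wt t * (f.val t * (coboundary k h g).val t) = (k + 1) * ∑' t, G t := by
    have e3 : ∀ t, X.wt t * (f.val t * (coboundary k h g).val t) =
        ∑ i : Fin (k + 1), G (permTuple i.cycleRange.symm t) := by
      intro t
      by_cases ht : X.IsOrdering t
      · rw [coboundary_val, cobFun_eq _ ht]
        have hw : X.wt t ≠ 0 := (X.wt_pos ht).ne'
        rw [show ∀ a b c : ℝ, a * (b * (a⁻¹ * c)) = a * a⁻¹ * (b * c) by intros; ring,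
          mul_inv_cancel₀ hw, one_mul, Finset.mul_sum]
        refine Finset.sum_congr rfl fun i _ => ?_
        have h3 := f.comp_perm i.cycleRange.symm t
        rw [Equiv.Perm.sign_symm] at h3
        have h4 : G (permTuple i.cycleRange.symm t) = f.val (t ∘ i.cycleRange.symm) *
            (X.wt (Fin.tail (t ∘ i.cycleRange.symm)) *
              g.val (Fin.tail (t ∘ i.cycleRange.symm))) := rfl
        rw [h4, h3]
        ring
      · rw [f.eq_zero ht]
        simp only [zero_mul, mul_zero]
        refine (Finset.sum_eq_zero fun i _ => ?_).symm
        have ht' : ¬ X.IsOrdering (permTuple i.cycleRange.symm t) :=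
          fun h' => ht ((X.isOrdering_comp _).mp h')
        simp [hG, f.eq_zero ht']
    rw [tsum_congr e3, Summable.tsum_finsetSum
      fun i _ => summable_perm hGsum _]
    simp only [tsum_perm G]
    simp
  have h3 : ((k + 1).factorial : ℝ)⁻¹ * (k + 1) = (k.factorial : ℝ)⁻¹ := by
    rw [Nat.factorial_succ]; push_cast; field_simp
  rw [L2Form.inner_def, L2Form.inner_def, e1, e2, ← h3]
  ring

theorem cobFun_cobFun {k : ℕ} (f : (Fin k → V) → ℝ) : X.cobFun (X.cobFun f) = 0 := by
  ext t
  by_cases ht : X.IsOrdering t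
  · have e : ∀ i : Fin (k + 2), X.wt (t ∘ i.succAbove) * X.cobFun f (t ∘ i.succAbove) =
        ∑ j : Fin (k + 1), (-1) ^ (j : ℕ) * (X.wt (t ∘ i.succAbove ∘ j.succAbove) *
          f (t ∘ i.succAbove ∘ j.succAbove)) := by
      intro i
      have hi := IsOrdering.succAbove X ht i
      rw [cobFun, if_pos hi, ← mul_assoc, mul_inv_cancel₀ (X.wt_pos hi).ne', one_mul]
      rfl
    have e2 : ∑ i : Fin (k + 2), (-1 : ℝ) ^ (i : ℕ) *
        (X.wt (t ∘ i.succAbove) * X.cobFun f (t ∘ i.succAbove)) = 0 := by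
      simp only [e, Finset.mul_sum]
      rw [← Fintype.sum_prod_type' (f := fun (i : Fin (k + 2)) (j : Fin (k + 1)) =>
        (-1 : ℝ) ^ (i : ℕ) * ((-1) ^ (j : ℕ) * (X.wt (t ∘ i.succAbove ∘ j.succAbove) *
          f (t ∘ i.succAbove ∘ j.succAbove))))]
      refine Finset.sum_involution
        (fun q _ => (q.1.succAbove q.2, q.2.predAbove q.1)) ?_ ?_ ?_ ?_
      · rintro ⟨i, j⟩ -
        have h1 : t ∘ (i.succAbove j).succAbove ∘ (j.predAbove i).succAbove =
            t ∘ i.succAbove ∘ j.succAbove := by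
          ext l
          simp [Fin.succAbove_succAbove_succAbove_predAbove]
        have h2 := Fin.neg_one_pow_succAbove_add_predAbove (R := ℝ) i j
        simp only [h1]
        rw [pow_add, pow_add] at h2
        linear_combination (X.wt (t ∘ i.succAbove ∘ j.succAbove) *
          f (t ∘ i.succAbove ∘ j.succAbove)) * h2
      · rintro ⟨i, j⟩ - - h
        exact Fin.succAbove_ne i j (congrArg Prod.fst h)
      · simp
      · rintro ⟨i, j⟩ -
        refine Prod.ext (Fin.succAbove_succAbove_predAbove i j) ?_
        ext
        simp only [Fin.succAbove, Fin.predAbove, Fin.lt_def, Fin.val_castSucc,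
          apply_dite Fin.val, Fin.val_pred, Fin.coe_castPred, dite_eq_ite, apply_ite Fin.val,
          Fin.val_succ]
        split_ifs <;> lia
    rw [cobFun, if_pos ht, e2, mul_zero, Pi.zero_apply]
  · simp [cobFun, ht]

variable (X)

/-! ### Upper Laplacian, cycles and spectral gap -/

/-- The upper Laplacian `Δ⁺ = ∂ δ` on square-summable forms on the cells with `k` vertices. -/
noncomputable def upLaplacian (k : ℕ) (h : X.DegreesBounded k) : X.L2Form k →L[ℝ] X.L2Form k :=
  (boundary k h).comp (coboundary k h)

/-- The square-summable forms (on the cells with `k` vertices) which are coboundaries of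
square-summable forms. No boundedness of the degrees of the cells with `k - 1` vertices is needed: the
coboundary of a square-summable form is always defined, but need not be square-summable. -/
noncomputable def coboundaries : (k : ℕ) → Submodule ℝ (X.L2Form k)
  | 0 => ⊥
  | k + 1 =>
    { carrier := {g | ∃ f : X.L2Form k, g.val = X.cobFun f.val}
      zero_mem' := ⟨0, by
        have := X.cobFun_smul (0 : ℝ) (0 : (Fin k → V) → ℝ)
        simpa using this.symm⟩
      add_mem' := by
        rintro g₁ g₂ ⟨f₁, h₁⟩ ⟨f₂, h₂⟩
        exact ⟨f₁ + f₂, by simp [h₁, h₂, cobFun_add]⟩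
      smul_mem' := by
        rintro c g ⟨f, h⟩
        exact ⟨c • f, by simp [h, cobFun_smul]⟩ }

/-- The space `Z`: the orthogonal complement of the square-summable coboundaries. -/
noncomputable def cycles (k : ℕ) : Submodule ℝ (X.L2Form k) := (X.coboundaries k)ᗮ

theorem upLaplacian_mem_cycles (k : ℕ) (h : X.DegreesBounded k) (f : X.L2Form k) :
    X.upLaplacian k h f ∈ X.cycles k := by
  rw [cycles, Submodule.mem_orthogonal']
  intro b hb
  rw [upLaplacian, ContinuousLinearMap.comp_apply, inner_boundary]
  have h0 : coboundary k h b = 0 := by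
    apply L2Form.ext_val
    rw [coboundary_val]
    cases k with
    | zero =>
      have : b = 0 := hb
      have h1 := X.cobFun_smul (0 : ℝ) (0 : (Fin 0 → V) → ℝ)
      simpa [this] using h1
    | succ k =>
      obtain ⟨g, hg⟩ := hb
      rw [hg, cobFun_cobFun]
      rfl
  rw [h0, inner_zero_right]

/-- The restriction of the upper Laplacian to `Z`. -/
noncomputable def upLaplacianOnCycles (k : ℕ) (h : X.DegreesBounded k) :
    X.cycles k →L[ℝ] X.cycles k :=
  ((X.upLaplacian k h).comp (X.cycles k).subtypeL).codRestrict (X.cycles k)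
    fun f => X.upLaplacian_mem_cycles k h f

/-- The spectrum of the upper Laplacian restricted to `Z`. -/
noncomputable def cycleSpectrum (k : ℕ) (h : X.DegreesBounded k) : Set ℝ :=
  spectrum ℝ (X.upLaplacianOnCycles k h)

/-- The minimum of the spectrum of the upper Laplacian restricted to `Z`. -/
noncomputable def gap (k : ℕ) (h : X.DegreesBounded k) : ℝ := sInf (X.cycleSpectrum k h)

/-- The spectral gap `λ(X)`. -/
noncomputable def spectralGap : ℝ := X.gap d X.degreesBounded

/-! ### Adjacency, balls and convergence -/

/-- The cells of dimension `d - 1`. -/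
def Ridge : Type _ := {s : Finset V // s ∈ X.cells ∧ s.card = d}

/-- Two `(d-1)`-cells are adjacent when their union is a `d`-cell. -/
def ridgeGraph : SimpleGraph X.Ridge where
  Adj s t := ∃ u ∈ X.cells, u.card = d + 1 ∧ (u : Set V) = (s.1 : Set V) ∪ (t.1 : Set V)
  symm := ⟨fun s t ⟨u, hu, hc, h⟩ => ⟨u, hu, hc, by rw [h, Set.union_comm]⟩⟩
  loopless := ⟨fun s ⟨u, hu, hc, h⟩ => by
    rw [Set.union_self, Finset.coe_inj] at h
    have := s.2.2
    rw [← h] at this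
    omega⟩

/-- `(d-1)`-connectedness: any two `(d-1)`-cells are joined by a chain of `(d-1)`-cells in which the
union of any two consecutive ones is a `d`-cell. -/
def IsRidgeConnected : Prop := X.ridgeGraph.Connected

/-- The ball of radius `n` around a `(d-1)`-cell `σ`: the subcomplex made of the `(d-1)`-cells at
distance at most `n` from `σ`, of their faces, and of the `d`-cells all of whose `(d-1)`-faces are at
distance at most `n` from `σ`. -/
def ball (σ : X.Ridge) (n : ℕ) : Set (Finset V) :=
  {s | (∃ ρ : X.Ridge, X.ridgeGraph.edist σ ρ ≤ n ∧ s ⊆ ρ.1) ∨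
    (s ∈ X.cells ∧ s.card = d + 1 ∧
      ∀ ρ : X.Ridge, ρ.1 ⊆ s → X.ridgeGraph.edist σ ρ ≤ n)}

/-- Balls of radius `n` around `σ` and `τ` are isomorphic, as complexes with a marked cell: some
bijection between their vertices induces a bijection between their cells and maps `σ` to `τ`. -/
def BallIso {W : Type*} (σ : X.Ridge) (Y : DComplex W d) (τ : Y.Ridge) (n : ℕ) : Prop :=
  ∃ φ : V → W, Set.InjOn φ (⋃ s ∈ X.ball σ n, (s : Set V)) ∧
    (∀ t : Finset W, t ∈ Y.ball τ n ↔ ∃ s ∈ X.ball σ n, (t : Set W) = φ '' (s : Set V)) ∧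
    (τ.1 : Set W) = φ '' (σ.1 : Set V)

/-- The distance between marked complexes `(X, σ)` and `(Y, τ)`: the infimum of `1 / (n + 1)` over
the `n` for which the balls of radius `n` around the marked cells are isomorphic. -/
noncomputable def markedDist {W : Type*} (σ : X.Ridge) (Y : DComplex W d) (τ : Y.Ridge) : ℝ :=
  sInf {x : ℝ | ∃ n : ℕ, X.BallIso σ Y τ n ∧ x = 1 / ((n : ℝ) + 1)}

/-- Convergence `Xₙ → Y` of complexes with globally bounded `(d-1)`-degrees: for some choice of
`(d-1)`-cells, the marked complexes converge. -/
def ConvergesTo {U : ℕ → Type*} {W : Type*} (X : ∀ n, DComplex (U n) d) (Y : DComplex W d) : Prop :=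
  (∃ K : ℕ, ∀ n, (X n).DegreesLE d K) ∧
    ∃ (σ : ∀ n, (X n).Ridge) (τ : Y.Ridge),
      Tendsto (fun n => (X n).markedDist (σ n) Y τ) atTop (𝓝 0)

/-- The `(d-1)`-skeletons of the complexes form a family of `(d-1)`-expanders: the degrees of the
`(d-2)`-cells are globally bounded, and the minimum of the spectrum of the upper Laplacian on
`(d-2)`-forms, restricted to `Z`, is bounded away from zero. -/
def SkeletonsExpand {U : ℕ → Type*} (X : ∀ n, DComplex (U n) d) : Prop :=
  ∃ (K : ℕ) (hK : ∀ n, (X n).DegreesLE (d - 1) K) (c : ℝ), 0 < c ∧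
    ∀ n, c ≤ (X n).gap (d - 1) ⟨K, hK n⟩

end DComplex

/-!
Write `Z` for the cycles, the orthogonal complement of the coboundaries. Since `L2Form` is complete and
`Δ⁺ = ∂δ` is symmetric, the gap is the infimum of the Rayleigh quotient `‖δ z‖² / ‖z‖²` over `Z`
(`gap_mul_le`, `exists_cycle_norm_coboundary_lt`), and it is an honest minimum, because the boundary of
a `d`-cell is a nonzero cycle (`cycles_ne_bot`). Let `a` be larger than the gap of the limit `Y`. A form
on `Y` supported near the marked cell can be copied to `Xₙ` for large `n`, along an isomorphism of large
balls, without changing the norms of the form and of its images under `∂`, `δ` and `Δ⁺`. But membership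
in `Z` is not local, so it has to be replaced by inequalities which hold for all forms and involve only
these norms.

* If the gap of `Xₙ` is at least `a > 0`, then `a ‖δ g‖² ≤ ‖Δ⁺ g‖²` for all forms `g`
  (`mul_norm_coboundary_le`). If the spectrum of `Y` on `Z` has a point `μ` with `0 < μ < a`, then an
  approximate eigenvector for `μ` violates this inequality on `Y` (`exists_norm_upLaplacian_lt`).
  When `0` is not in the spectrum, `μ` is the gap itself; when `0` is not isolated, `μ` is a small
  positive point of the spectrum.
* If moreover the gap of `Xₙ` one dimension lower is at least `c > 0`, then
  `‖g‖² ≤ c⁻¹ ‖∂ g‖² + a⁻¹ ‖δ g‖²` for all `g` (`norm_sq_le_boundary_add_coboundary`). A cycle of `Y`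
  of Rayleigh quotient below `a` violates it, as it satisfies `∂ z = 0`.

In both cases the violation is a strict inequality between continuous functions of the form, so it
persists after restricting the form to a large ball (`tendsto_restrictNear`), and the restricted form
is copied to `Xₙ` (`exists_form_val_eq_pull` and the norm identities following it), which shows that the
gap of `Xₙ` is less than `a` for all large `n`.
-/

/-! ### Symmetric operators on real Hilbert spaces -/

section Symmetric

variable {H : Type*} [NormedAddCommGroup H] [InnerProductSpace ℝ H]

theorem LinearMap.IsSymmetric.norm_sq_le_of_inner_nonneg {P : H →L[ℝ] H}
    (hP : (P : H →ₗ[ℝ] H).IsSymmetric) (h0 : ∀ x, 0 ≤ inner ℝ (P x) x) {c : ℝ} (hc : 0 < c)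
    (hPc : ‖P‖ ≤ c) (x : H) : ‖P x‖ ^ 2 ≤ c * inner ℝ (P x) x := by
  -- Expand the nonnegative form `⟨P y, y⟩` at `y = x - c⁻¹ P x`.
  have h1 := h0 (x - c⁻¹ • P x)
  have h2 : inner ℝ (P (P x)) (P x) ≤ c * ‖P x‖ ^ 2 := by
    refine (real_inner_le_norm _ _).trans ?_
    rw [pow_two, ← mul_assoc]
    exact mul_le_mul_of_nonneg_right ((P.le_opNorm _).trans (by gcongr)) (norm_nonneg _)
  have h3 : inner ℝ (P (P x)) x = ‖P x‖ ^ 2 := by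
    have := hP (P x) x
    simp only [ContinuousLinearMap.coe_coe] at this
    rw [this, real_inner_self_eq_norm_sq]
  rw [map_sub, map_smul, inner_sub_left, inner_sub_right, inner_sub_right, inner_smul_left,
    inner_smul_left, inner_smul_right, inner_smul_right, h3, real_inner_self_eq_norm_sq] at h1
  simp only [conj_trivial] at h1
  have h4 : c⁻¹ * (c⁻¹ * inner ℝ (P (P x)) (P x)) ≤ c⁻¹ * ‖P x‖ ^ 2 := by
    have := mul_le_mul_of_nonneg_left h2 (by positivity : 0 ≤ c⁻¹ * c⁻¹)
    have hcc : c⁻¹ * c⁻¹ * (c * ‖P x‖ ^ 2) = c⁻¹ * ‖P x‖ ^ 2 := by field_simp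
    linarith
  have h5 : c⁻¹ * ‖P x‖ ^ 2 ≤ inner ℝ (P x) x := by linarith
  calc ‖P x‖ ^ 2 = c * (c⁻¹ * ‖P x‖ ^ 2) := by field_simp
    _ ≤ _ := mul_le_mul_of_nonneg_left h5 hc.le

theorem isSymmetric_algebraMap_sub {T : H →L[ℝ] H} (hT : (T : H →ₗ[ℝ] H).IsSymmetric) (μ : ℝ) :
    ((algebraMap ℝ (H →L[ℝ] H) μ - T : H →L[ℝ] H) : H →ₗ[ℝ] H).IsSymmetric := by
  intro x y
  have := hT x y
  simp only [ContinuousLinearMap.coe_coe] at this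
  simp [Algebra.algebraMap_eq_smul_one, inner_sub_left, inner_sub_right, inner_smul_left,
    inner_smul_right, this]

theorem neg_norm_mul_le_inner (T : H →L[ℝ] H) (x : H) : -‖T‖ * ‖x‖ ^ 2 ≤ inner ℝ (T x) x := by
  have h1 := neg_le_of_abs_le (abs_real_inner_le_norm (T x) x)
  have h2 := mul_le_mul_of_nonneg_right (T.le_opNorm x) (norm_nonneg x)
  nlinarith

variable [CompleteSpace H] {T : H →L[ℝ] H}

/-- Every point of the spectrum of a symmetric operator is an approximate eigenvalue: a symmetric
operator which is bounded below is invertible. -/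
theorem exists_approx_eigenvector (hT : (T : H →ₗ[ℝ] H).IsSymmetric) {μ : ℝ}
    (hμ : μ ∈ spectrum ℝ T) {ε : ℝ} (hε : 0 < ε) : ∃ x, ‖T x - μ • x‖ < ε * ‖x‖ := by
  by_contra! hbelow
  refine hμ ?_
  set S : H →L[ℝ] H := algebraMap ℝ (H →L[ℝ] H) μ - T with hS
  have hSx : ∀ x, S x = -(T x - μ • x) := fun x => by
    simp [hS, Algebra.algebraMap_eq_smul_one]
  have hSlow : ∀ x, ε * ‖x‖ ≤ ‖S x‖ := fun x => by
    rw [hSx, norm_neg]; exact hbelow x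
  have hSs := isSymmetric_algebraMap_sub hT μ
  change IsUnit S
  rw [ContinuousLinearMap.isUnit_iff_bijective,
    ContinuousLinearMap.bijective_iff_dense_range_and_antilipschitz]
  refine ⟨?_, ⟨⟨ε⁻¹, by positivity⟩, S.antilipschitz_of_bound fun x => ?_⟩⟩
  · rw [Submodule.topologicalClosure_eq_top_iff, Submodule.eq_bot_iff]
    intro x hx
    have h0 : S x = 0 := by
      rw [← inner_self_eq_zero (𝕜 := ℝ)]
      have h1 := hSs (S x) x
      have h2 := hx (S (S x)) ⟨_, rfl⟩
      simp only [ContinuousLinearMap.coe_coe] at h1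
      rw [← hS] at h1
      rw [← h1, h2]
    have := hSlow x
    rw [h0, norm_zero] at this
    exact norm_le_zero_iff.mp (nonpos_of_mul_nonpos_right this hε)
  · change ‖x‖ ≤ ε⁻¹ * ‖S x‖
    rw [le_inv_mul_iff₀ hε]
    exact hSlow x

theorem le_of_mem_spectrum (hT : (T : H →ₗ[ℝ] H).IsSymmetric) {a : ℝ}
    (ha : ∀ x, a * ‖x‖ ^ 2 ≤ inner ℝ (T x) x) {μ : ℝ} (hμ : μ ∈ spectrum ℝ T) : a ≤ μ := by
  refine le_of_forall_pos_le_add fun ε hε => ?_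
  obtain ⟨x, hx⟩ := exists_approx_eigenvector hT hμ hε
  have hx0 : 0 < ‖x‖ := by
    by_contra h
    have := (norm_nonneg (T x - μ • x)).trans_lt hx
    have h0 : ‖x‖ = 0 := le_antisymm (not_lt.mp h) (norm_nonneg _)
    rw [h0] at this
    simp at this
  have h1 : inner ℝ (T x) x - μ * ‖x‖ ^ 2 ≤ ε * ‖x‖ * ‖x‖ := by
    have := real_inner_le_norm (T x - μ • x) x
    rw [inner_sub_left, real_inner_smul_left, real_inner_self_eq_norm_sq] at this
    exact this.trans (mul_le_mul_of_nonneg_right hx.le (norm_nonneg _))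
  have h2 := ha x
  have h3 : a * ‖x‖ ^ 2 ≤ (μ + ε) * ‖x‖ ^ 2 := by nlinarith
  exact le_of_mul_le_mul_right h3 (by positivity)

/-- The infimum of the Rayleigh quotient of a symmetric operator belongs to the spectrum. -/
theorem exists_mem_spectrum_forall_le [Nontrivial H] (hT : (T : H →ₗ[ℝ] H).IsSymmetric) :
    ∃ m ∈ spectrum ℝ T, ∀ x, m * ‖x‖ ^ 2 ≤ inner ℝ (T x) x := by
  set R : Set ℝ := {r | ∃ x : H, x ≠ 0 ∧ r = inner ℝ (T x) x / ‖x‖ ^ 2} with hR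
  have hpos : ∀ x : H, x ≠ 0 → 0 < ‖x‖ ^ 2 := fun x hx => by
    have := norm_pos_iff.mpr hx
    positivity
  have hbdd : BddBelow R := by
    refine ⟨-‖T‖, ?_⟩
    rintro r ⟨x, hx, rfl⟩
    rw [le_div_iff₀ (hpos x hx)]
    exact neg_norm_mul_le_inner T x
  have hne : R.Nonempty := by
    obtain ⟨x, hx⟩ := exists_ne (0 : H)
    exact ⟨_, x, hx, rfl⟩
  have hle : ∀ x, sInf R * ‖x‖ ^ 2 ≤ inner ℝ (T x) x := by
    intro x
    rcases eq_or_ne x 0 with rfl | hx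
    · simp
    rw [← le_div_iff₀ (hpos x hx)]
    exact csInf_le hbdd ⟨x, hx, rfl⟩
  refine ⟨sInf R, fun hunit => ?_, hle⟩
  set m := sInf R
  -- If `m - T` were invertible, then `T - m ≥ 0` would be bounded below by a positive constant.
  set S : H →L[ℝ] H := algebraMap ℝ (H →L[ℝ] H) m - T with hS
  have hSx : ∀ x, (-S) x = T x - m • x := fun x => by
    simp [hS, Algebra.algebraMap_eq_smul_one]
  have hSs : ((-S : H →L[ℝ] H) : H →ₗ[ℝ] H).IsSymmetric := by
    intro x y
    have := isSymmetric_algebraMap_sub hT m x y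
    simp only [ContinuousLinearMap.coe_coe] at this ⊢
    simp [← hS] at this
    simp [this]
  have hin : ∀ x, inner ℝ ((-S) x) x = inner ℝ (T x) x - m * ‖x‖ ^ 2 := fun x => by
    rw [hSx, inner_sub_left, real_inner_smul_left, real_inner_self_eq_norm_sq]
  have hnn : ∀ x, 0 ≤ inner ℝ ((-S) x) x := fun x => by
    rw [hin]; linarith [hle x]
  obtain ⟨⟨K, hK⟩⟩ : Nonempty {K : NNReal // AntilipschitzWith K S} := by
    change IsUnit S at hunit
    rw [ContinuousLinearMap.isUnit_iff_bijective,
      ContinuousLinearMap.bijective_iff_dense_range_and_antilipschitz] at hunit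
    obtain ⟨-, K, hK⟩ := hunit
    exact ⟨⟨K, hK⟩⟩
  have hlow : ∀ x, ‖x‖ ≤ K * ‖(-S) x‖ := fun x => by
    have := hK.le_mul_dist x 0
    simpa using this
  set c : ℝ := ‖-S‖ + 1
  have hc : 0 < c := by positivity
  set e : ℝ := ((K : ℝ) ^ 2 + 1) * c with he
  have he0 : 0 < e := by positivity
  have hgap : ∀ x, ‖x‖ ^ 2 ≤ e * inner ℝ ((-S) x) x := fun x => by
    have h1 := hSs.norm_sq_le_of_inner_nonneg hnn hc (by simp [c]) x
    have h2 : ‖x‖ ^ 2 ≤ (K * ‖(-S) x‖) ^ 2 := pow_le_pow_left₀ (norm_nonneg _) (hlow x) 2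
    rw [mul_pow] at h2
    have h3 := mul_le_mul_of_nonneg_left h1 (sq_nonneg (K : ℝ))
    have h4 := mul_nonneg hc.le (hnn x)
    rw [he]
    nlinarith
  have hcontra : m + e⁻¹ ≤ m := by
    refine le_csInf hne ?_
    rintro r ⟨x, hx, rfl⟩
    rw [le_div_iff₀ (hpos x hx)]
    have h1 := mul_le_mul_of_nonneg_left (hgap x) (inv_nonneg.mpr he0.le)
    rw [inv_mul_cancel_left₀ he0.ne', hin] at h1
    linarith
  have : 0 < e⁻¹ := by positivity
  linarith

theorem sInf_spectrum_mem [Nontrivial H] (hT : (T : H →ₗ[ℝ] H).IsSymmetric) :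
    sInf (spectrum ℝ T) ∈ spectrum ℝ T := by
  obtain ⟨m, hm, hle⟩ := exists_mem_spectrum_forall_le hT
  have hleast : IsLeast (spectrum ℝ T) m := ⟨hm, fun μ hμ => le_of_mem_spectrum hT hle hμ⟩
  rwa [hleast.csInf_eq]

theorem sInf_spectrum_mul_le (hT : (T : H →ₗ[ℝ] H).IsSymmetric) (x : H) :
    sInf (spectrum ℝ T) * ‖x‖ ^ 2 ≤ inner ℝ (T x) x := by
  rcases eq_or_ne x 0 with rfl | hx
  · simp
  have : Nontrivial H := ⟨x, 0, hx⟩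
  obtain ⟨m, hm, hle⟩ := exists_mem_spectrum_forall_le hT
  refine le_trans (mul_le_mul_of_nonneg_right ?_ (sq_nonneg _)) (hle x)
  exact csInf_le ⟨_, fun μ hμ => le_of_mem_spectrum hT (neg_norm_mul_le_inner T) hμ⟩ hm

end Symmetric

namespace DComplex

/-! ### Completeness of the spaces of forms -/

section Forms

variable {V : Type*} {d : ℕ} {X : DComplex V d} {k : ℕ}

theorem memLp_scaled (f : X.L2Form k) :
    Memℓp (fun t => √((k.factorial : ℝ)⁻¹ * X.wt t) * f.val t) 2 := by
  refine memℓp_gen ?_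
  refine (f.summable_sq.mul_left (k.factorial : ℝ)⁻¹).congr fun t => ?_
  have h0 : 0 ≤ (k.factorial : ℝ)⁻¹ * X.wt t := mul_nonneg (by positivity) (X.wt_nonneg t)
  simp only [ENNReal.toReal_ofNat, Real.rpow_ofNat, Real.norm_eq_abs, sq_abs, mul_pow,
    Real.sq_sqrt h0]
  ring

variable (X k) in
/-- The isometric embedding of the forms into `ℓ²` of the tuples which multiplies by the square root
of the normalized weight. -/
noncomputable def scaledIsometry : X.L2Form k →ₗᵢ[ℝ] lp (fun _ : Fin k → V => ℝ) 2 where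
  toFun f := ⟨fun t => √((k.factorial : ℝ)⁻¹ * X.wt t) * f.val t, memLp_scaled f⟩
  map_add' f g := by
    ext t
    exact mul_add _ _ _
  map_smul' c f := by
    ext t
    simp [mul_left_comm]
  norm_map' f := by
    refine (sq_eq_sq₀ (norm_nonneg _) (norm_nonneg _)).mp ?_
    rw [← real_inner_self_eq_norm_sq, lp.inner_eq_tsum, L2Form.norm_sq, ← tsum_mul_left]
    refine tsum_congr fun t => ?_
    have h0 : 0 ≤ (k.factorial : ℝ)⁻¹ * X.wt t := mul_nonneg (by positivity) (X.wt_nonneg t)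
    have h1 := Real.mul_self_sqrt h0
    simp only [LinearMap.coe_mk, AddHom.coe_mk, RCLike.inner_apply, conj_trivial]
    linear_combination (f.val t ^ 2) * h1

theorem scaledIsometry_apply (f : X.L2Form k) (t : Fin k → V) :
    scaledIsometry X k f t = √((k.factorial : ℝ)⁻¹ * X.wt t) * f.val t := rfl

/-- Vanishing off the orderings of cells and antisymmetry are closed conditions. -/
theorem range_scaledIsometry : Set.range (scaledIsometry X k) =
    {x | (∀ t, ¬ X.IsOrdering t → x t = 0) ∧
      ∀ (p : Equiv.Perm (Fin k)) t, x (t ∘ p) = ((Equiv.Perm.sign p : ℤ) : ℝ) * x t} := by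
  ext x
  constructor
  · rintro ⟨f, rfl⟩
    refine ⟨fun t ht => ?_, fun p t => ?_⟩
    · rw [scaledIsometry_apply, f.eq_zero ht, mul_zero]
    · rw [scaledIsometry_apply, scaledIsometry_apply, X.wt_comp, f.comp_perm]
      ring
  · rintro ⟨h1, h2⟩
    set s : (Fin k → V) → ℝ := fun t => √((k.factorial : ℝ)⁻¹ * X.wt t) with hs
    have hspos : ∀ t, X.IsOrdering t → 0 < s t := fun t ht =>
      Real.sqrt_pos.mpr (mul_pos (by positivity) (X.wt_pos ht))
    have hssq : ∀ t, s t ^ 2 = (k.factorial : ℝ)⁻¹ * X.wt t := fun t =>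
      Real.sq_sqrt (mul_nonneg (by positivity) (X.wt_nonneg t))
    have hsum : Summable fun t => x t ^ 2 := by
      have := (memℓp_gen_iff (p := 2) (by simp)).mp (lp.memℓp x)
      simpa using this
    let f : X.L2Form k := ⟨fun t => (s t)⁻¹ * x t, fun t ht => by simp [h1 t ht], fun p t => by
      have : s (t ∘ p) = s t := by simp only [hs, X.wt_comp]
      simp only [this, h2]; ring, by
      refine Summable.of_nonneg_of_le (fun t => mul_nonneg (X.wt_nonneg t) (sq_nonneg _))
        (fun t => ?_) (hsum.mul_left (k.factorial : ℝ))
      by_cases ht : X.IsOrdering t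
      · have hf : (0 : ℝ) < k.factorial := by positivity
        have hw := hssq t
        have hp := hspos t ht
        have : X.wt t = k.factorial * s t ^ 2 := by rw [hw]; field_simp
        rw [this]
        refine le_of_eq ?_
        field_simp
      · simp [h1 t ht]⟩
    refine ⟨f, ?_⟩
    ext t
    rw [scaledIsometry_apply]
    change s t * ((s t)⁻¹ * x t) = x t
    by_cases ht : X.IsOrdering t
    · rw [mul_inv_cancel_left₀ (hspos t ht).ne']
    · simp [h1 t ht]

instance : CompleteSpace (X.L2Form k) := by
  rw [completeSpace_iff_isComplete_range (scaledIsometry X k).isometry.isUniformInducing,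
    range_scaledIsometry]
  refine IsClosed.isComplete ?_
  have hev : ∀ t, Continuous fun x : lp (fun _ : Fin k → V => ℝ) 2 => x t := fun t =>
    (lp.evalCLM ℝ (fun _ : Fin k → V => ℝ) 2 t).continuous
  simp only [Set.ofPred_and, Set.ofPred_forall]
  refine IsClosed.inter ?_ ?_
  · exact isClosed_iInter fun t => isClosed_iInter fun _ => isClosed_eq (hev t) continuous_const
  · exact isClosed_iInter fun p => isClosed_iInter fun t =>
      isClosed_eq (hev _) (continuous_const.mul (hev t))

/-! ### The decomposition into cycles and limits of coboundaries -/

theorem inner_upLaplacian (h : X.DegreesBounded k) (f g : X.L2Form k) :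
    inner ℝ (X.upLaplacian k h f) g = inner ℝ (coboundary k h f) (coboundary k h g) :=
  inner_boundary h _ _

theorem coboundary_eq_zero_of_mem_coboundaries (h : X.DegreesBounded k) {b : X.L2Form k}
    (hb : b ∈ X.coboundaries k) : coboundary k h b = 0 := by
  rw [← inner_self_eq_zero (𝕜 := ℝ), ← inner_upLaplacian, real_inner_comm]
  exact X.upLaplacian_mem_cycles k h b b hb

theorem boundary_mem_cycles (h : X.DegreesBounded k) (f : X.L2Form (k + 1)) :
    boundary k h f ∈ X.cycles k := by
  rw [cycles, Submodule.mem_orthogonal']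
  intro b hb
  rw [inner_boundary, coboundary_eq_zero_of_mem_coboundaries h hb, inner_zero_right]

theorem coboundary_eq_zero_of_mem_orthogonal (h : X.DegreesBounded k) {b : X.L2Form k}
    (hb : b ∈ (X.cycles k)ᗮ) : coboundary k h b = 0 := by
  rw [← inner_self_eq_zero (𝕜 := ℝ), ← inner_upLaplacian]
  exact hb _ (X.upLaplacian_mem_cycles k h b)

theorem boundary_eq_zero_of_mem_cycles (h : X.DegreesBounded k) {z : X.L2Form (k + 1)}
    (hz : z ∈ X.cycles (k + 1)) : boundary k h z = 0 := by
  rw [← inner_self_eq_zero (𝕜 := ℝ), inner_boundary, real_inner_comm]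
  exact hz _ ⟨_, coboundary_val h _⟩

instance : CompleteSpace (X.cycles k) :=
  (Submodule.isClosed_orthogonal _).completeSpace_coe

theorem exists_cycle_add (g : X.L2Form k) :
    ∃ z ∈ X.cycles k, ∃ b ∈ (X.cycles k)ᗮ, g = z + b :=
  (X.cycles k).exists_add_mem_mem_orthogonal g

theorem isSymmetric_upLaplacianOnCycles (h : X.DegreesBounded k) :
    (X.upLaplacianOnCycles k h : X.cycles k →ₗ[ℝ] X.cycles k).IsSymmetric := by
  intro x y
  change inner ℝ (X.upLaplacian k h x) (y : X.L2Form k) =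
    inner ℝ (x : X.L2Form k) (X.upLaplacian k h y)
  rw [inner_upLaplacian, real_inner_comm _ (x : X.L2Form k), inner_upLaplacian, real_inner_comm]

theorem inner_upLaplacianOnCycles_self (h : X.DegreesBounded k) (z : X.cycles k) :
    inner ℝ (X.upLaplacianOnCycles k h z) z = ‖coboundary k h (z : X.L2Form k)‖ ^ 2 := by
  rw [← real_inner_self_eq_norm_sq, ← inner_upLaplacian]
  rfl

/-! ### Variational bounds for the spectral gap -/

theorem nonneg_of_mem_cycleSpectrum (h : X.DegreesBounded k) {μ : ℝ}
    (hμ : μ ∈ X.cycleSpectrum k h) : 0 ≤ μ :=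
  le_of_mem_spectrum (isSymmetric_upLaplacianOnCycles h) (fun z => by
    rw [inner_upLaplacianOnCycles_self, zero_mul]; positivity) hμ

theorem gap_nonneg (h : X.DegreesBounded k) : 0 ≤ X.gap k h :=
  Real.sInf_nonneg fun _ hμ => nonneg_of_mem_cycleSpectrum h hμ

theorem gap_mul_le (h : X.DegreesBounded k) {z : X.L2Form k} (hz : z ∈ X.cycles k) :
    X.gap k h * ‖z‖ ^ 2 ≤ ‖coboundary k h z‖ ^ 2 := by
  have := sInf_spectrum_mul_le (isSymmetric_upLaplacianOnCycles h) ⟨z, hz⟩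
  rwa [inner_upLaplacianOnCycles_self] at this

/-- The infimum defining the gap is attained, so the gap is an honest minimum, as soon as there are
nonzero cycles. -/
theorem gap_mem_cycleSpectrum (h : X.DegreesBounded k) (hne : X.cycles k ≠ ⊥) :
    X.gap k h ∈ X.cycleSpectrum k h := by
  have : Nontrivial (X.cycles k) := Submodule.nontrivial_iff_ne_bot.mpr hne
  exact sInf_spectrum_mem (isSymmetric_upLaplacianOnCycles h)

theorem exists_cycle_norm_coboundary_lt (h : X.DegreesBounded k) (hne : X.cycles k ≠ ⊥) {a : ℝ}
    (ha : X.gap k h < a) : ∃ z ∈ X.cycles k, ‖coboundary k h z‖ ^ 2 < a * ‖z‖ ^ 2 := by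
  by_contra! hcon
  refine absurd (le_of_mem_spectrum (isSymmetric_upLaplacianOnCycles h) (fun z => ?_)
    (gap_mem_cycleSpectrum h hne)) (not_le.mpr ha)
  rw [inner_upLaplacianOnCycles_self]
  exact hcon z z.2

/-- A lower bound `a` for the gap says `Δ⁺(Δ⁺ - a) ≥ 0` on all forms, not only on cycles, since `Δ⁺`
vanishes on the orthogonal complement of the cycles. -/
theorem mul_norm_coboundary_le (h : X.DegreesBounded k) {a : ℝ} (ha : 0 < a)
    (hgap : a ≤ X.gap k h) (g : X.L2Form k) :
    a * ‖coboundary k h g‖ ^ 2 ≤ ‖X.upLaplacian k h g‖ ^ 2 := by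
  obtain ⟨z, hz, b, hb, rfl⟩ := exists_cycle_add g
  have h0 := coboundary_eq_zero_of_mem_orthogonal h hb
  have h1 : X.upLaplacian k h (z + b) = X.upLaplacian k h z := by
    simp only [upLaplacian, ContinuousLinearMap.comp_apply, map_add, h0, map_zero, add_zero]
  rw [h1, map_add, h0, add_zero]
  have h2 : a * ‖z‖ ^ 2 ≤ ‖coboundary k h z‖ ^ 2 :=
    (mul_le_mul_of_nonneg_right hgap (sq_nonneg _)).trans (gap_mul_le h hz)
  have h3 : ‖coboundary k h z‖ ^ 2 ≤ ‖X.upLaplacian k h z‖ * ‖z‖ := by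
    rw [← real_inner_self_eq_norm_sq, ← inner_upLaplacian]
    exact real_inner_le_norm _ _
  rcases (norm_nonneg (coboundary k h z)).eq_or_lt with h4 | h4
  · rw [← h4]; simp
  · have h5 : (‖coboundary k h z‖ ^ 2) * (a * ‖coboundary k h z‖ ^ 2) ≤
        (‖coboundary k h z‖ ^ 2) * ‖X.upLaplacian k h z‖ ^ 2 := by
      have h6 := pow_le_pow_left₀ (sq_nonneg _) h3 2
      have h7 := mul_le_mul_of_nonneg_left h2 (sq_nonneg ‖X.upLaplacian k h z‖)
      nlinarith
    exact le_of_mul_le_mul_left h5 (by positivity)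

/-- Testing on an approximate eigenvector of eigenvalue `μ`, the ratio of `‖Δ⁺ f‖²` and `‖δ f‖²` is
close to `μ`. -/
theorem exists_norm_upLaplacian_lt (h : X.DegreesBounded k) {μ a : ℝ}
    (hμ : μ ∈ X.cycleSpectrum k h) (hμ0 : 0 < μ) (hμa : μ < a) :
    ∃ f : X.L2Form k, ‖X.upLaplacian k h f‖ ^ 2 < a * ‖coboundary k h f‖ ^ 2 := by
  obtain ⟨ε, hε, hεμ, hεa⟩ : ∃ ε : ℝ, 0 < ε ∧ ε < μ ∧ (μ + ε) ^ 2 < a * (μ - ε) := by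
    have hcont : Continuous fun ε : ℝ => a * (μ - ε) - (μ + ε) ^ 2 := by fun_prop
    have h0 : 0 < a * (μ - 0) - (μ + 0) ^ 2 := by nlinarith
    have h1 : ∀ᶠ ε in 𝓝[>] (0 : ℝ), 0 < a * (μ - ε) - (μ + ε) ^ 2 :=
      (hcont.tendsto 0).mono_left nhdsWithin_le_nhds |>.eventually_const_lt h0
    have h2 : ∀ᶠ ε in 𝓝[>] (0 : ℝ), ε < μ :=
      (tendsto_id.mono_left nhdsWithin_le_nhds).eventually_lt_const hμ0
    obtain ⟨ε, ⟨h3, h4⟩, h5⟩ := ((h1.and h2).and self_mem_nhdsWithin).exists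
    exact ⟨ε, h5, h4, by linarith⟩
  obtain ⟨x, hx⟩ := exists_approx_eigenvector (isSymmetric_upLaplacianOnCycles h) hμ hε
  set z : X.L2Form k := x.1
  replace hx : ‖X.upLaplacian k h z - μ • z‖ < ε * ‖z‖ := hx
  have hz : 0 < ‖z‖ := by
    by_contra hz
    have h0 : ‖z‖ = 0 := le_antisymm (not_lt.mp hz) (norm_nonneg _)
    have := (norm_nonneg _).trans_lt hx
    simp [h0] at this
  refine ⟨z, ?_⟩
  have h1 : ‖X.upLaplacian k h z‖ ≤ (μ + ε) * ‖z‖ := by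
    have h2 := norm_sub_norm_le (X.upLaplacian k h z) (μ • z)
    rw [norm_smul, Real.norm_eq_abs, abs_of_pos hμ0] at h2
    linarith
  have h2 : (μ - ε) * ‖z‖ ^ 2 ≤ ‖coboundary k h z‖ ^ 2 := by
    have h3 := (abs_le.mp ((abs_real_inner_le_norm (X.upLaplacian k h z - μ • z) z).trans
      (mul_le_mul_of_nonneg_right hx.le (norm_nonneg _)))).1
    rw [inner_sub_left, real_inner_smul_left, inner_upLaplacian, real_inner_self_eq_norm_sq,
      real_inner_self_eq_norm_sq] at h3
    nlinarith
  calc ‖X.upLaplacian k h z‖ ^ 2 ≤ ((μ + ε) * ‖z‖) ^ 2 := pow_le_pow_left₀ (norm_nonneg _) h1 2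
    _ = (μ + ε) ^ 2 * ‖z‖ ^ 2 := by ring
    _ < a * (μ - ε) * ‖z‖ ^ 2 := mul_lt_mul_of_pos_right hεa (by positivity)
    _ = a * ((μ - ε) * ‖z‖ ^ 2) := by ring
    _ ≤ _ := mul_le_mul_of_nonneg_left h2 (hμ0.trans hμa).le

/-- A gap one dimension lower makes `∂` bounded below on the limits of coboundaries, because every
coboundary is the coboundary of a cycle. -/
theorem mul_norm_sq_le_norm_boundary (h : X.DegreesBounded k) {c : ℝ} (hc : 0 < c)
    (hgap : c ≤ X.gap k h) {b : X.L2Form (k + 1)} (hb : b ∈ (X.cycles (k + 1))ᗮ) :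
    c * ‖b‖ ^ 2 ≤ ‖boundary k h b‖ ^ 2 := by
  rw [cycles, Submodule.orthogonal_orthogonal_eq_closure] at hb
  have hclosed : IsClosed {b : X.L2Form (k + 1) | c * ‖b‖ ^ 2 ≤ ‖boundary k h b‖ ^ 2} :=
    isClosed_le (by fun_prop) (by fun_prop)
  refine closure_minimal ?_ hclosed hb
  rintro b ⟨f, hf⟩
  obtain ⟨z, hz, b', hb', rfl⟩ := exists_cycle_add f
  have hbz : b = coboundary k h z := by
    have h0 := coboundary_eq_zero_of_mem_orthogonal h hb'
    have : b = coboundary k h (z + b') := L2Form.ext_val hf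
    rw [this, map_add, h0, add_zero]
  have h1 : c * ‖z‖ ^ 2 ≤ ‖b‖ ^ 2 := by
    rw [hbz]
    exact (mul_le_mul_of_nonneg_right hgap (sq_nonneg _)).trans (gap_mul_le h hz)
  have h2 : ‖b‖ ^ 2 ≤ ‖boundary k h b‖ * ‖z‖ := by
    rw [← real_inner_self_eq_norm_sq]
    conv_lhs => rw [hbz, ← inner_boundary, ← hbz]
    exact real_inner_le_norm _ _
  change c * ‖b‖ ^ 2 ≤ ‖boundary k h b‖ ^ 2
  rcases (norm_nonneg b).eq_or_lt with h4 | h4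
  · rw [← h4]; simp
  · have h5 : ‖b‖ ^ 2 * (c * ‖b‖ ^ 2) ≤ ‖b‖ ^ 2 * ‖boundary k h b‖ ^ 2 := by
      have h6 := pow_le_pow_left₀ (sq_nonneg _) h2 2
      have h7 := mul_le_mul_of_nonneg_left h1 (sq_nonneg ‖boundary k h b‖)
      nlinarith
    exact le_of_mul_le_mul_left h5 (by positivity)

/-- If the gaps in two consecutive dimensions are bounded below, then `∂` and `δ` together control the
norm of every form. -/
theorem norm_sq_le_boundary_add_coboundary (h : X.DegreesBounded k)
    (h' : X.DegreesBounded (k + 1)) {a c : ℝ} (ha : 0 < a) (hc : 0 < c)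
    (hgap : c ≤ X.gap k h) (hgap' : a ≤ X.gap (k + 1) h') (g : X.L2Form (k + 1)) :
    ‖g‖ ^ 2 ≤ c⁻¹ * ‖boundary k h g‖ ^ 2 + a⁻¹ * ‖coboundary (k + 1) h' g‖ ^ 2 := by
  obtain ⟨z, hz, b, hb, rfl⟩ := exists_cycle_add g
  rw [map_add, map_add, boundary_eq_zero_of_mem_cycles h hz, zero_add,
    coboundary_eq_zero_of_mem_orthogonal h' hb, add_zero, pow_two ‖z + b‖,
    norm_add_sq_eq_norm_sq_add_norm_sq_of_inner_eq_zero z b (hb z hz)]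
  have h1 := mul_norm_sq_le_norm_boundary h hc hgap hb
  have h2 : a * ‖z‖ ^ 2 ≤ ‖coboundary (k + 1) h' z‖ ^ 2 :=
    (mul_le_mul_of_nonneg_right hgap' (sq_nonneg _)).trans (gap_mul_le h' hz)
  rw [mul_comm, ← le_div_iff₀ hc] at h1
  rw [mul_comm, ← le_div_iff₀ ha] at h2
  rw [inv_mul_eq_div, inv_mul_eq_div, ← pow_two, ← pow_two]
  linarith

/-! ### Existence of nonzero cycles -/

open Classical in
/-- The form which is `±1` on the orderings of one given cell and `0` elsewhere. -/
noncomputable def cellForm {t₀ : Fin k → V} (h : X.IsOrdering t₀) : X.L2Form k :=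
  ⟨fun t => ∑ p : Equiv.Perm (Fin k), if t = t₀ ∘ p then ((Equiv.Perm.sign p : ℤ) : ℝ) else 0, by
    refine ⟨fun t ht => ?_, fun q t => ?_, ?_⟩
    · refine Finset.sum_eq_zero fun p _ => if_neg ?_
      rintro rfl
      exact ht ((X.isOrdering_comp p).mpr h)
    · rw [Finset.mul_sum]
      refine (Equiv.sum_comp (Equiv.mulRight q) _).symm.trans ?_
      refine Finset.sum_congr rfl fun p _ => ?_
      have : t ∘ q = t₀ ∘ (Equiv.mulRight q p) ↔ t = t₀ ∘ p := by
        rw [Equiv.coe_mulRight, Equiv.Perm.coe_mul, ← Function.comp_assoc]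
        exact q.surjective.injective_comp_right.eq_iff
      rw [mul_ite, mul_zero]
      refine if_congr this ?_ rfl
      simp [mul_comm]
    · refine summable_of_hasFiniteSupport ((Set.finite_range
        fun p : Equiv.Perm (Fin k) => t₀ ∘ p).subset fun t ht => ?_)
      by_contra hcon
      refine ht ?_
      have : (∑ p : Equiv.Perm (Fin k),
          if t = t₀ ∘ p then ((Equiv.Perm.sign p : ℤ) : ℝ) else 0) = 0 :=
        Finset.sum_eq_zero fun p _ => if_neg fun h => hcon ⟨p, h.symm⟩
      simp only [this]; simp⟩

theorem cellForm_self {t₀ : Fin k → V} (h : X.IsOrdering t₀) : (cellForm h).val t₀ = 1 := by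
  classical
  change (∑ p : Equiv.Perm (Fin k), if t₀ = t₀ ∘ p then ((Equiv.Perm.sign p : ℤ) : ℝ) else 0) = 1
  rw [Finset.sum_eq_single 1]
  · simp
  · intro p _ hp
    refine if_neg fun h' => hp ?_
    ext i
    exact congrArg Fin.val (h.1 (congrFun h' i)).symm
  · simp

theorem exists_perm_of_cellForm_ne_zero {t₀ t : Fin k → V} (h : X.IsOrdering t₀)
    (ht : (cellForm h).val t ≠ 0) : ∃ p : Equiv.Perm (Fin k), t = t₀ ∘ p := by
  classical
  by_contra hcon
  exact ht (Finset.sum_eq_zero fun p _ => if_neg fun h' => hcon ⟨p, h'⟩)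

theorem exists_isOrdering : ∃ t : Fin (d + 1) → V, X.IsOrdering t := by
  obtain ⟨s, hs, -, hc⟩ := X.uniform ∅ X.empty_mem
  refine ⟨fun i => s.equivFin.symm (Fin.cast hc.symm i), ?_, ?_⟩
  · intro i j hij
    simpa using hij
  · convert hs
    apply Finset.coe_injective
    rw [coe_verts]
    ext v
    constructor
    · rintro ⟨i, rfl⟩
      exact (s.equivFin.symm _).2
    · intro hv
      exact ⟨Fin.cast hc (s.equivFin ⟨v, hv⟩), by simp⟩

/-- The boundary of a single `d`-cell is a nonzero cycle. -/
theorem cycles_ne_bot (h : X.DegreesBounded d) : X.cycles d ≠ ⊥ := by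
  obtain ⟨t, ht⟩ := X.exists_isOrdering
  intro hbot
  have h0 : boundary d h (cellForm ht) = 0 := by
    have := boundary_mem_cycles h (cellForm ht)
    rwa [hbot, Submodule.mem_bot] at this
  have h1 : bdFun (cellForm ht).val (Fin.tail t) = 0 := by
    rw [← boundary_val h, h0]; rfl
  have h2 : bdFun (cellForm ht).val (Fin.tail t) = 1 := by
    rw [bdFun, finsum_eq_single _ (t 0), Fin.cons_self_tail, cellForm_self]
    intro v hv
    by_contra hne
    obtain ⟨p, hp⟩ := exists_perm_of_cellForm_ne_zero ht hne
    obtain ⟨j, hj⟩ := p.surjective 0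
    have h3 : (Fin.cons v (Fin.tail t) : Fin (d + 1) → V) j = t 0 := by
      rw [hp, Function.comp_apply, hj]
    refine Fin.cases (fun h3 => hv h3) (fun i h3 => ?_) j h3
    rw [Fin.cons_succ] at h3
    exact Fin.succ_ne_zero i (ht.1 h3)
  rw [h1] at h2
  exact zero_ne_one h2

end Forms

/-! ### Codimension-one cells near a given one -/

section Near

variable {V : Type*} {d : ℕ} {X : DComplex V d}

/-- The `(d-1)`-cells at distance at most `j` from `σ`, as a set of cells. -/
def near (σ : X.Ridge) (j : ℕ) : Set (Finset V) :=
  {s | ∃ ρ : X.Ridge, ρ.1 = s ∧ X.ridgeGraph.edist σ ρ ≤ j}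

variable {σ : X.Ridge} {j m : ℕ} {s t u : Finset V}

theorem card_of_mem_near (h : s ∈ near σ j) : s.card = d := by
  obtain ⟨ρ, rfl, -⟩ := h; exact ρ.2.2

theorem exists_ridge_eq (hs : s ∈ X.cells) (hc : s.card = d) : ∃ ρ : X.Ridge, ρ.1 = s :=
  ⟨⟨s, hs, hc⟩, rfl⟩

theorem mem_near_zero : s ∈ near σ 0 ↔ s = σ.1 := by
  constructor
  · rintro ⟨ρ, rfl, h⟩
    rw [Nat.cast_zero, nonpos_iff_eq_zero, SimpleGraph.edist_eq_zero_iff] at h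
    rw [h]
  · rintro rfl
    exact ⟨σ, rfl, by simp⟩

theorem near_mono (h : j ≤ m) : near σ j ⊆ near σ m := by
  rintro s ⟨ρ, rfl, hρ⟩
  exact ⟨ρ, rfl, hρ.trans (by exact_mod_cast h)⟩

theorem union_eq_of_card [DecidableEq V] (hs : s.card = d) (ht : t.card = d)
    (hu : u.card = d + 1) (hsu : s ⊆ u) (htu : t ⊆ u) (hne : s ≠ t) : s ∪ t = u := by
  refine Finset.eq_of_subset_of_card_le (Finset.union_subset hsu htu) ?_
  by_contra hlt
  have h1 : s ∪ t = s := (Finset.eq_of_subset_of_card_le Finset.subset_union_left (by omega)).symm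
  have h2 : s ∪ t = t := (Finset.eq_of_subset_of_card_le Finset.subset_union_right (by omega)).symm
  exact hne (h1.symm.trans h2)

/-- Two facets of one `d`-cell are equal or adjacent. -/
theorem mem_near_succ_of_facets (hs : s ∈ near σ j) (hu : u ∈ X.cells) (huc : u.card = d + 1)
    (hsu : s ⊆ u) (htu : t ⊆ u) (ht : t.card = d) : t ∈ near σ (j + 1) := by
  classical
  by_cases hst : s = t
  · subst hst
    exact near_mono (Nat.le_succ j) hs
  obtain ⟨ρ, rfl, hρ⟩ := hs
  obtain ⟨ρ', rfl⟩ := exists_ridge_eq (X.down_closed u hu t htu) ht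
  have hadj : X.ridgeGraph.Adj ρ ρ' := ⟨u, hu, huc, by
    rw [← Finset.coe_union]
    exact congrArg _ (union_eq_of_card ρ.2.2 ht huc hsu htu hst).symm⟩
  refine ⟨ρ', rfl, ?_⟩
  calc _ ≤ _ := SimpleGraph.edist_triangle (v := ρ)
    _ ≤ j + 1 := add_le_add hρ (SimpleGraph.edist_eq_one_iff_adj.mpr hadj).le
    _ = _ := by push_cast; rfl

theorem exists_of_mem_near_succ (h : t ∈ near σ (j + 1)) : t = σ.1 ∨
    ∃ s ∈ near σ j, ∃ u ∈ X.cells, u.card = d + 1 ∧ s ⊆ u ∧ t ⊆ u := by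
  obtain ⟨ρ, rfl, hρ⟩ := h
  have hne : X.ridgeGraph.edist ρ σ ≠ ⊤ := by
    rw [SimpleGraph.edist_comm]
    exact ne_top_of_le_ne_top (ENat.natCast_ne_top _) hρ
  obtain ⟨p, hp⟩ := SimpleGraph.exists_walk_of_edist_ne_top hne
  rw [SimpleGraph.edist_comm, ← hp] at hρ
  cases p with
  | nil => exact Or.inl rfl
  | cons hadj q =>
    rename_i ρ'
    obtain ⟨u, hu, huc, hun⟩ := hadj
    refine Or.inr ⟨ρ'.1, ⟨ρ', rfl, ?_⟩, u, hu, huc, ?_, ?_⟩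
    · rw [SimpleGraph.edist_comm]
      refine (SimpleGraph.edist_le q).trans ?_
      change ((q.length + 1 : ℕ) : ℕ∞) ≤ ((j + 1 : ℕ) : ℕ∞) at hρ
      have : q.length + 1 ≤ j + 1 := by exact_mod_cast hρ
      exact_mod_cast Nat.le_of_succ_le_succ this
    · rw [← Finset.coe_subset, hun]; exact Set.subset_union_right
    · rw [← Finset.coe_subset, hun]; exact Set.subset_union_left

theorem exists_mem_near (hX : X.IsRidgeConnected) (σ : X.Ridge) (hs : s ∈ X.cells)
    (hc : s.card = d) : ∃ j, s ∈ near σ j := by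
  obtain ⟨p, hp⟩ := SimpleGraph.Connected.exists_walk_length_eq_edist hX σ ⟨s, hs, hc⟩
  exact ⟨p.length, ⟨s, hs, hc⟩, rfl, hp.ge⟩

theorem ball_subset_cells (σ : X.Ridge) (m : ℕ) : X.ball σ m ⊆ X.cells := by
  rintro s (⟨ρ, -, hs⟩ | ⟨hs, -⟩)
  · exact X.down_closed _ ρ.2.1 _ hs
  · exact hs

theorem mem_ball_of_mem_near (h : s ∈ near σ m) : s ∈ X.ball σ m := by
  obtain ⟨ρ, rfl, hρ⟩ := h
  exact Or.inl ⟨ρ, hρ, subset_rfl⟩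

theorem mem_ball_of_subset (h : s ∈ X.ball σ m) (hts : t ⊆ s) : t ∈ X.ball σ m := by
  rcases h with ⟨ρ, hρ, hs⟩ | ⟨hs, hc, hall⟩
  · exact Or.inl ⟨ρ, hρ, hts.trans hs⟩
  · by_cases htc : t = s
    · subst htc
      exact Or.inr ⟨hs, hc, hall⟩
    -- A proper face of a `d`-cell lies in one of its facets.
    · have hlt := Finset.card_lt_card (hts.ssubset_of_ne htc)
      obtain ⟨r, htr, hrs, hrc⟩ := Finset.exists_subsuperset_card_eq hts
        (by omega : t.card ≤ d) (by omega)
      exact Or.inl ⟨⟨r, X.down_closed _ hs _ hrs, hrc⟩, hall _ hrs, htr⟩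

theorem mem_ball_of_facet_mem_near (hs : s ∈ near σ j) (hjm : j + 1 ≤ m) (hu : u ∈ X.cells)
    (huc : u.card = d + 1) (hsu : s ⊆ u) : u ∈ X.ball σ m := by
  refine Or.inr ⟨hu, huc, fun ρ hρ => ?_⟩
  obtain ⟨ρ', h1, h2⟩ := mem_near_succ_of_facets hs hu huc hsu hρ ρ.2.2
  obtain rfl : ρ' = ρ := Subtype.ext h1
  exact h2.trans (by exact_mod_cast hjm)

end Near

/-! ### Isomorphisms of balls -/

open Classical in
/-- An isomorphism between the balls of radius `m` around `σ` and `τ`, with its inverse: the two maps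
are arbitrary outside the vertices of the balls. -/
structure BallEquiv {V W : Type*} {d : ℕ} {X : DComplex V d} {Y : DComplex W d} (σ : X.Ridge)
    (τ : Y.Ridge) (m : ℕ) where
  toFun : V → W
  invFun : W → V
  image_mem : ∀ s ∈ X.ball σ m, s.image toFun ∈ Y.ball τ m
  image_inv_mem : ∀ s ∈ Y.ball τ m, s.image invFun ∈ X.ball σ m
  inv_apply : ∀ s ∈ X.ball σ m, ∀ v ∈ s, invFun (toFun v) = v
  apply_inv : ∀ s ∈ Y.ball τ m, ∀ w ∈ s, toFun (invFun w) = w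
  image_base : σ.1.image toFun = τ.1

section Iso

variable {V W : Type*} {d : ℕ} {X : DComplex V d} {Y : DComplex W d} {σ : X.Ridge} {τ : Y.Ridge}
  {m j : ℕ}

theorem exists_ballEquiv [Nonempty V] (h : X.BallIso σ Y τ m) : Nonempty (BallEquiv σ τ m) := by
  classical
  obtain ⟨φ, hinj, hball, hbase⟩ := h
  set A : Set V := ⋃ s ∈ X.ball σ m, (s : Set V) with hA
  have hmemA : ∀ s ∈ X.ball σ m, ∀ v ∈ s, v ∈ A := fun s hs v hv =>
    Set.mem_biUnion hs (Finset.mem_coe.mpr hv)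
  have hinv : ∀ v ∈ A, Function.invFunOn φ A (φ v) = v := fun v hv =>
    hinj.leftInvOn_invFunOn hv
  refine ⟨⟨φ, Function.invFunOn φ A, fun s hs => ?_, fun t ht => ?_, fun s hs v hv => ?_,
    fun t ht w hw => ?_, ?_⟩⟩
  · exact (hball _).mpr ⟨s, hs, Finset.coe_image⟩
  · obtain ⟨s, hs, hts⟩ := (hball t).mp ht
    have : t.image (Function.invFunOn φ A) = s := by
      have h1 : t = s.image φ := by
        apply Finset.coe_injective
        rw [hts, Finset.coe_image]
      rw [h1, Finset.image_image]
      exact (Finset.image_congr fun v hv => hinv v (hmemA s hs v hv)).trans Finset.image_id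
    rwa [this]
  · exact hinv v (hmemA s hs v hv)
  · obtain ⟨s, hs, hts⟩ := (hball t).mp ht
    obtain ⟨v, hv, rfl⟩ : w ∈ φ '' (s : Set V) := hts ▸ Finset.mem_coe.mpr hw
    rw [hinv v (hmemA s hs v hv)]
  · apply Finset.coe_injective
    rw [Finset.coe_image, hbase]

namespace BallEquiv

theorem base_mem_ball (σ : X.Ridge) (m : ℕ) : σ.1 ∈ X.ball σ m :=
  mem_ball_of_mem_near (near_mono (Nat.zero_le m) (mem_near_zero.mpr rfl))

open Classical in
theorem image_inv_image (E : BallEquiv σ τ m) {s : Finset V} (hs : s ∈ X.ball σ m) :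
    (s.image E.toFun).image E.invFun = s := by
  rw [Finset.image_image]
  exact (Finset.image_congr fun v hv => E.inv_apply s hs v hv).trans Finset.image_id

/-- The inverse isomorphism. -/
def symm (E : BallEquiv σ τ m) : BallEquiv τ σ m where
  toFun := E.invFun
  invFun := E.toFun
  image_mem := E.image_inv_mem
  image_inv_mem := E.image_mem
  inv_apply := E.apply_inv
  apply_inv := E.inv_apply
  image_base := by
    rw [← E.image_base]
    exact E.image_inv_image (base_mem_ball σ m)

variable (E : BallEquiv σ τ m)

open Classical in
theorem card_image {s : Finset V} (hs : s ∈ X.ball σ m) : (s.image E.toFun).card = s.card :=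
  Finset.card_image_of_injOn fun v hv w hw hvw => by
    rw [← E.inv_apply s hs v hv, ← E.inv_apply s hs w hw, hvw]

open Classical in
theorem image_mem_near {s : Finset V} (hjm : j ≤ m) (hs : s ∈ near σ j) :
    s.image E.toFun ∈ near τ j := by
  induction j generalizing s with
  | zero => rw [mem_near_zero] at hs ⊢; rw [hs, E.image_base]
  | succ j ih =>
    have hsc := card_of_mem_near hs
    have hsb : s ∈ X.ball σ m := mem_ball_of_mem_near (near_mono hjm hs)
    rcases exists_of_mem_near_succ hs with rfl | ⟨r, hr, u, hu, huc, hru, hsu⟩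
    · rw [E.image_base]
      exact near_mono (Nat.zero_le _) (mem_near_zero.mpr rfl)
    · have hub : u ∈ X.ball σ m := mem_ball_of_facet_mem_near hr hjm hu huc hru
      refine mem_near_succ_of_facets (ih (by omega) hr) (ball_subset_cells τ m (E.image_mem u hub))
        ?_ (Finset.image_subset_image hru) (Finset.image_subset_image hsu) ?_
      · rw [E.card_image hub, huc]
      · rw [E.card_image hsb, hsc]

open Classical in
theorem degree_le {s : Finset V} (hjm : j + 1 ≤ m) (hs : s ∈ near σ j) :
    X.degree s ≤ Y.degree (s.image E.toFun) := by
  have hsc := card_of_mem_near hs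
  have hsb : s ∈ X.ball σ m := mem_ball_of_mem_near (near_mono (by omega) hs)
  have hball : ∀ u ∈ X.cells, s ⊆ u → u.card = s.card + 1 → u ∈ X.ball σ m :=
    fun u hu hsu huc => mem_ball_of_facet_mem_near hs hjm hu (by omega) hsu
  refine Set.encard_le_encard_of_injOn (f := Finset.image E.toFun) ?_ ?_
  · rintro u ⟨hu, hsu, huc⟩
    have hub := hball u hu hsu huc
    refine ⟨ball_subset_cells τ m (E.image_mem u hub), Finset.image_subset_image hsu, ?_⟩
    rw [E.card_image hub, E.card_image hsb, huc]
  · rintro u ⟨hu, hsu, huc⟩ u' ⟨hu', hsu', huc'⟩ h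
    rw [← E.image_inv_image (hball u hu hsu huc), h, E.image_inv_image (hball u' hu' hsu' huc')]

open Classical in
theorem degree_image {s : Finset V} (hjm : j + 1 ≤ m) (hs : s ∈ near σ j) :
    Y.degree (s.image E.toFun) = X.degree s := by
  refine le_antisymm ?_ (E.degree_le hjm hs)
  have h := E.symm.degree_le hjm (E.image_mem_near (by omega) hs)
  have h2 : (s.image E.toFun).image E.symm.toFun = s :=
    E.image_inv_image (mem_ball_of_mem_near (near_mono (by omega) hs))
  rwa [h2] at h

open Classical in
theorem weight_image {s : Finset V} (hjm : j + 1 ≤ m) (hs : s ∈ near σ j) :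
    Y.weight (s.image E.toFun) = X.weight s := by
  have hsb : s ∈ X.ball σ m := mem_ball_of_mem_near (near_mono (by omega) hs)
  rw [weight, weight, E.card_image hsb, E.degree_image hjm hs]

end BallEquiv

/-! ### Convergence provides isomorphisms of arbitrarily large balls -/

theorem mem_ball_zero (hd : 1 ≤ d) {s : Finset V} : s ∈ X.ball σ 0 ↔ s ⊆ σ.1 := by
  constructor
  · rintro (⟨ρ, hρ, hs⟩ | ⟨hs, hc, hall⟩)
    · rw [Nat.cast_zero, nonpos_iff_eq_zero, SimpleGraph.edist_eq_zero_iff] at hρ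
      rwa [hρ]
    -- A `d`-cell with a single facet would have fewer than `d + 1` vertices, as `1 ≤ d`.
    · intro v hv
      obtain ⟨w, hw, hwv⟩ : ∃ w ∈ s, w ≠ v := by
        by_contra! h
        have := Finset.card_le_one.mpr fun a ha b hb => (h a ha).trans (h b hb).symm
        omega
      classical
      have hc' : (s.erase w).card = d := by rw [Finset.card_erase_of_mem hw]; omega
      obtain ⟨ρ, hρ⟩ := exists_ridge_eq (X.down_closed _ hs _ (Finset.erase_subset w s)) hc'
      have h1 := hall ρ (hρ ▸ Finset.erase_subset w s)
      rw [Nat.cast_zero, nonpos_iff_eq_zero, SimpleGraph.edist_eq_zero_iff] at h1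
      rw [h1, hρ]
      exact Finset.mem_erase.mpr ⟨hwv.symm, hv⟩
  · intro h
    exact Or.inl ⟨σ, by simp, h⟩

/-- Balls of radius `0` are always isomorphic: they are simplices of dimension `d - 1`. So the set
whose infimum is the distance of marked complexes is never empty. -/
theorem ballIso_zero (hd : 1 ≤ d) (σ : X.Ridge) (τ : Y.Ridge) : X.BallIso σ Y τ 0 := by
  classical
  have hτ : Nonempty W := by
    obtain ⟨w, -⟩ := Finset.card_pos.mp (τ.2.2.symm ▸ hd : 0 < τ.1.card)
    exact ⟨w⟩
  obtain ⟨φ, hφ⟩ := (σ.1.finite_toSet).exists_bijOn_of_encard_eq (t := (τ.1 : Set W)) (by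
    rw [Set.encard_coe_eq_coe_finsetCard, Set.encard_coe_eq_coe_finsetCard, σ.2.2, τ.2.2])
  have hU : (⋃ s ∈ X.ball σ 0, (s : Set V)) ⊆ σ.1 :=
    Set.iUnion₂_subset fun s hs => Finset.coe_subset.mpr ((mem_ball_zero hd).mp hs)
  refine ⟨φ, hφ.injOn.mono hU, fun t => ?_, hφ.image_eq.symm⟩
  rw [mem_ball_zero hd]
  constructor
  · intro ht
    have ht' : (t : Set W) ⊆ φ '' σ.1 := by rw [hφ.image_eq]; exact_mod_cast ht
    obtain ⟨s, hs, hst⟩ := Finset.subset_set_image_iff.mp ht'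
    exact ⟨s, (mem_ball_zero hd).mpr (by exact_mod_cast hs), by rw [← hst, Finset.coe_image]⟩
  · rintro ⟨s, hs, hst⟩
    rw [← Finset.coe_subset, hst, ← hφ.image_eq]
    exact Set.image_mono (Finset.coe_subset.mpr ((mem_ball_zero hd).mp hs))

theorem exists_ballEquiv_of_markedDist_lt (hd : 1 ≤ d) {r : ℕ}
    (h : X.markedDist σ Y τ < 1 / ((r : ℝ) + 1)) : ∃ m, r ≤ m ∧ Nonempty (BallEquiv σ τ m) := by
  have : Nonempty V := by
    obtain ⟨v, -⟩ := Finset.card_pos.mp (σ.2.2.symm ▸ hd : 0 < σ.1.card)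
    exact ⟨v⟩
  obtain ⟨x, ⟨n, hn, rfl⟩, hx⟩ := exists_lt_of_csInf_lt
    (s := {x : ℝ | ∃ n : ℕ, X.BallIso σ Y τ n ∧ x = 1 / ((n : ℝ) + 1)})
    ⟨_, 0, ballIso_zero hd σ τ, rfl⟩ h
  refine ⟨n, ?_, exists_ballEquiv hn⟩
  have h1 := lt_of_one_div_lt_one_div (by positivity) hx
  have h2 : (r : ℝ) < n := by linarith
  exact_mod_cast h2.le

end Iso

theorem ConvergesTo.eventually_ballEquiv {d : ℕ} (hd : 1 ≤ d) {U : ℕ → Type*} {W : Type*}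
    {X : ∀ n, DComplex (U n) d} {Y : DComplex W d} (h : ConvergesTo X Y) :
    ∃ (σ : ∀ n, (X n).Ridge) (τ : Y.Ridge), ∀ r : ℕ,
      ∀ᶠ n in atTop, ∃ m, r ≤ m ∧ Nonempty (BallEquiv (σ n) τ m) := by
  obtain ⟨-, σ, τ, hlim⟩ := h
  refine ⟨σ, τ, fun r => ?_⟩
  have hr : (0 : ℝ) < 1 / ((r : ℝ) + 1) := by positivity
  exact (hlim.eventually_lt_const hr).mono fun n hn => exists_ballEquiv_of_markedDist_lt hd hn

/-! ### Pulling forms back along an isomorphism of balls -/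

section Transport

variable {V W : Type*} {d k : ℕ} {X : DComplex V d} {Y : DComplex W d} {σ : X.Ridge} {τ : Y.Ridge}
  {m j : ℕ}

/-- `t` is an ordering of the vertices of a cell in the ball of radius `m` around `σ`. -/
def InBall (σ : X.Ridge) (m : ℕ) (t : Fin k → V) : Prop :=
  Function.Injective t ∧ verts t ∈ X.ball σ m

/-- The function `f` on `d`-tuples vanishes off the orderings of `(d-1)`-cells at distance at most `j`
from `σ`. -/
def SupportedNear (σ : X.Ridge) (j : ℕ) (f : (Fin d → V) → ℝ) : Prop :=
  ∀ t, f t ≠ 0 → Function.Injective t ∧ verts t ∈ near σ j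

theorem InBall.isOrdering {t : Fin k → V} (h : InBall σ m t) : X.IsOrdering t :=
  ⟨h.1, ball_subset_cells σ m h.2⟩

theorem verts_comp_subset {l : ℕ} (t : Fin k → V) (e : Fin l → Fin k) :
    verts (t ∘ e) ⊆ verts t := by
  rw [← Finset.coe_subset, coe_verts, coe_verts]
  exact Set.range_comp_subset_range _ _

theorem InBall.comp {l : ℕ} {t : Fin k → V} (h : InBall σ m t) {e : Fin l → Fin k}
    (he : Function.Injective e) : InBall σ m (t ∘ e) :=
  ⟨h.1.comp he, mem_ball_of_subset h.2 (verts_comp_subset t e)⟩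

theorem inBall_comp_perm {t : Fin k → V} (p : Equiv.Perm (Fin k)) :
    InBall σ m (t ∘ p) ↔ InBall σ m t := by
  unfold InBall
  rw [verts_comp, p.injective_comp]

theorem inBall_of_facet {t : Fin (d + 1) → V} (ht : X.IsOrdering t) (hjm : j + 1 ≤ m)
    {i : Fin (d + 1)} (hi : verts (t ∘ i.succAbove) ∈ near σ j) : InBall σ m t :=
  ⟨ht.1, mem_ball_of_facet_mem_near hi hjm ht.2 (card_verts ht.1) (verts_comp_subset _ _)⟩

theorem SupportedNear.inBall {f : (Fin d → V) → ℝ} (hf : SupportedNear σ j f) (hjm : j ≤ m)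
    (t : Fin d → V) (ht : f t ≠ 0) : InBall σ m t :=
  ⟨(hf t ht).1, mem_ball_of_mem_near (near_mono hjm (hf t ht).2)⟩

/-- If `δ f` does not vanish on a `d`-cell, then `f` does not vanish on one of its facets. -/
theorem exists_facet_of_cobFun_ne_zero {f : (Fin k → V) → ℝ} {t : Fin (k + 1) → V}
    (h : X.cobFun f t ≠ 0) : X.IsOrdering t ∧ ∃ i : Fin (k + 1), f (t ∘ i.succAbove) ≠ 0 := by
  classical
  by_cases ht : X.IsOrdering t
  · refine ⟨ht, ?_⟩
    by_contra! hall
    exact h (by simp [cobFun, ht, hall])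
  · exact absurd (if_neg ht) h

theorem SupportedNear.inBall_of_cobFun_ne_zero {f : (Fin d → V) → ℝ} (hf : SupportedNear σ j f)
    (hjm : j + 1 ≤ m) (t : Fin (d + 1) → V) (h : X.cobFun f t ≠ 0) : InBall σ m t := by
  obtain ⟨ht, i, hi⟩ := exists_facet_of_cobFun_ne_zero h
  exact inBall_of_facet ht hjm (hf _ hi).2

theorem SupportedNear.bdFun_cobFun {f : (Fin d → V) → ℝ} (hf : SupportedNear σ j f) :
    SupportedNear σ (j + 1) (bdFun (X.cobFun f)) := by
  intro t ht
  obtain ⟨v, hv⟩ : ∃ v, X.cobFun f (Fin.cons v t) ≠ 0 := by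
    by_contra! hall
    exact ht (by simp [bdFun, hall])
  obtain ⟨h1, i, hi⟩ := exists_facet_of_cobFun_ne_zero hv
  have h2 : t = (Fin.cons v t : Fin (d + 1) → V) ∘ Fin.succ := by
    ext l; simp
  have hinj : Function.Injective t := by
    rw [h2]; exact h1.1.comp (Fin.succ_injective _)
  refine ⟨hinj, mem_near_succ_of_facets (hf _ hi).2 h1.2 (card_verts h1.1)
    (verts_comp_subset _ _) ?_ (card_verts hinj)⟩
  conv_lhs => rw [h2]
  exact verts_comp_subset _ _

namespace BallEquiv

variable (E : BallEquiv σ τ m)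

open Classical in
theorem verts_map (t : Fin k → V) : verts (E.toFun ∘ t) = (verts t).image E.toFun := by
  apply Finset.coe_injective
  rw [Finset.coe_image, coe_verts, coe_verts, Set.range_comp]

theorem inv_comp {t : Fin k → V} (ht : InBall σ m t) : E.invFun ∘ (E.toFun ∘ t) = t := by
  ext i
  refine E.inv_apply _ ht.2 _ ?_
  rw [← Finset.mem_coe, coe_verts]
  exact Set.mem_range_self i

theorem inBall_map {t : Fin k → V} (ht : InBall σ m t) : InBall τ m (E.toFun ∘ t) := by
  classical
  refine ⟨?_, ?_⟩
  · have h := ht.1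
    rw [← E.inv_comp ht] at h
    exact h.of_comp
  · rw [verts_map]
    exact E.image_mem _ ht.2

/-- The orderings of cells in isomorphic balls correspond to each other. -/
def tupleEquiv (k : ℕ) : {t : Fin k → V // InBall σ m t} ≃ {t : Fin k → W // InBall τ m t} where
  toFun t := ⟨E.toFun ∘ t.1, E.inBall_map t.2⟩
  invFun t := ⟨E.invFun ∘ t.1, E.symm.inBall_map t.2⟩
  left_inv t := Subtype.ext (E.inv_comp t.2)
  right_inv t := Subtype.ext (E.symm.inv_comp t.2)

open Classical in
/-- The pull-back of a function on tuples along an isomorphism of balls, extended by zero. -/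
noncomputable def pull (f : (Fin k → W) → ℝ) (t : Fin k → V) : ℝ :=
  if InBall σ m t then f (E.toFun ∘ t) else 0

theorem pull_of_inBall (f : (Fin k → W) → ℝ) {t : Fin k → V} (ht : InBall σ m t) :
    E.pull f t = f (E.toFun ∘ t) := if_pos ht

theorem pull_of_not_inBall (f : (Fin k → W) → ℝ) {t : Fin k → V} (ht : ¬ InBall σ m t) :
    E.pull f t = 0 := if_neg ht

theorem hasSum_pull {f : (Fin k → W) → ℝ} {a : ℝ} (hf : ∀ t, f t ≠ 0 → InBall τ m t)
    (h : HasSum f a) : HasSum (E.pull f) a := by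
  have h1 : HasSum (f ∘ (Subtype.val : {t // InBall τ m t} → Fin k → W)) a :=
    (hasSum_subtype_iff_of_support_subset (s := {t | InBall τ m t}) hf).mpr h
  have h2 := (E.tupleEquiv k).hasSum_iff.mpr h1
  have h3 : E.pull f ∘ Subtype.val =
      (f ∘ (Subtype.val : {t // InBall τ m t} → Fin k → W)) ∘ E.tupleEquiv k :=
    funext fun t => E.pull_of_inBall f t.2
  rw [← h3] at h2
  refine (hasSum_subtype_iff_of_support_subset (s := {t | InBall σ m t}) fun t ht => ?_).mp h2
  by_contra hcon
  exact ht (E.pull_of_not_inBall f hcon)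

theorem wt_map_of_near {t : Fin d → V} (hjm : j + 1 ≤ m)
    (ht : verts t ∈ near σ j) : Y.wt (E.toFun ∘ t) = X.wt t := by
  classical
  rw [wt, verts_map, E.weight_image hjm ht, wt]

theorem wt_map_of_supportedNear {f : (Fin d → W) → ℝ} (hf : SupportedNear τ j f)
    (hjm : j + 1 ≤ m) {t : Fin d → V} (ht : InBall σ m t) (h : f (E.toFun ∘ t) ≠ 0) :
    Y.wt (E.toFun ∘ t) = X.wt t := by
  classical
  refine E.wt_map_of_near hjm ?_
  have h1 := E.symm.image_mem_near (by omega) (hf _ h).2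
  rwa [← E.symm.verts_map, show E.symm.toFun ∘ E.toFun ∘ t = t from E.inv_comp ht] at h1

theorem wt_eq_one (hk : k ≠ d) {t : Fin k → V} (ht : Function.Injective t) : X.wt t = 1 := by
  rw [wt, weight, card_verts ht, if_neg hk]

theorem wt_map_of_ne (hk : k ≠ d) {t : Fin k → V} (ht : InBall σ m t) :
    Y.wt (E.toFun ∘ t) = X.wt t := by
  rw [wt_eq_one hk ht.1, wt_eq_one hk (E.inBall_map ht).1]

theorem hasSum_pull_sq (g : Y.L2Form k) (hg : ∀ t, g.val t ≠ 0 → InBall τ m t)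
    (hw : ∀ t, InBall σ m t → g.val (E.toFun ∘ t) ≠ 0 → Y.wt (E.toFun ∘ t) = X.wt t) :
    HasSum (fun t => X.wt t * E.pull g.val t ^ 2) (∑' t, Y.wt t * g.val t ^ 2) := by
  have h := E.hasSum_pull (fun t ht => hg t fun h => ht (by simp [h])) g.summable_sq.hasSum
  convert h using 2 with t
  by_cases ht : InBall σ m t
  · rw [E.pull_of_inBall _ ht, E.pull_of_inBall _ ht]
    by_cases h0 : g.val (E.toFun ∘ t) = 0
    · simp [h0]
    · rw [hw t ht h0]
  · rw [E.pull_of_not_inBall _ ht, E.pull_of_not_inBall _ ht]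
    simp

theorem norm_eq_of_val_eq_pull {f : X.L2Form k} {g : Y.L2Form k} (hfg : f.val = E.pull g.val)
    (hg : ∀ t, g.val t ≠ 0 → InBall τ m t)
    (hw : ∀ t, InBall σ m t → g.val (E.toFun ∘ t) ≠ 0 → Y.wt (E.toFun ∘ t) = X.wt t) :
    ‖f‖ = ‖g‖ := by
  refine (sq_eq_sq₀ (norm_nonneg _) (norm_nonneg _)).mp ?_
  rw [L2Form.norm_sq, L2Form.norm_sq, hfg, (E.hasSum_pull_sq g hg hw).tsum_eq]

/-- The pull-back of a form supported in a ball strictly inside the one where the isomorphism is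
defined, so that the weights are preserved. -/
theorem exists_form_val_eq_pull (g : Y.L2Form d) (hg : SupportedNear τ j g.val)
    (hjm : j + 1 ≤ m) : ∃ f : X.L2Form d, f.val = E.pull g.val := by
  refine ⟨⟨E.pull g.val, fun t ht => E.pull_of_not_inBall _ fun h => ht h.isOrdering,
    fun p t => ?_, (E.hasSum_pull_sq g (hg.inBall (by omega))
      fun t ht h => E.wt_map_of_supportedNear hg hjm ht h).summable⟩, rfl⟩
  by_cases ht : InBall σ m t
  · rw [E.pull_of_inBall _ ht, E.pull_of_inBall _ ((inBall_comp_perm p).mpr ht),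
      ← Function.comp_assoc, g.comp_perm]
  · rw [E.pull_of_not_inBall _ ht, E.pull_of_not_inBall _ fun h => ht ((inBall_comp_perm p).mp h),
      mul_zero]

theorem cobFun_pull {g : (Fin d → W) → ℝ} (hg : SupportedNear τ j g) (hjm : j + 1 ≤ m) :
    X.cobFun (E.pull g) = E.pull (Y.cobFun g) := by
  classical
  ext t
  by_cases ht : InBall σ m t
  · rw [E.pull_of_inBall _ ht, cobFun, cobFun, if_pos ht.isOrdering,
      if_pos (E.inBall_map ht).isOrdering, E.wt_map_of_ne (Nat.succ_ne_self d) ht]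
    congr 1
    refine Finset.sum_congr rfl fun i _ => ?_
    have hi : InBall σ m (t ∘ i.succAbove) := ht.comp Fin.succAbove_right_injective
    rw [E.pull_of_inBall _ hi, Function.comp_assoc]
    by_cases h0 : g (E.toFun ∘ t ∘ i.succAbove) = 0
    · simp [h0]
    · rw [E.wt_map_of_supportedNear hg hjm hi h0]
  · rw [E.pull_of_not_inBall _ ht]
    by_contra hne
    obtain ⟨hto, i, hi⟩ := exists_facet_of_cobFun_ne_zero hne
    have hb : InBall σ m (t ∘ i.succAbove) := by
      by_contra hcon
      exact hi (E.pull_of_not_inBall _ hcon)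
    rw [E.pull_of_inBall _ hb] at hi
    have h1 := E.symm.image_mem_near (by omega) (hg _ hi).2
    rw [← E.symm.verts_map, show E.symm.toFun ∘ E.toFun ∘ t ∘ i.succAbove = t ∘ i.succAbove
      from E.inv_comp hb] at h1
    exact ht (inBall_of_facet hto hjm h1)

theorem comp_cons (φ : V → W) (v : V) (t : Fin k → V) :
    φ ∘ (Fin.cons v t : Fin (k + 1) → V) = Fin.cons (φ v) (φ ∘ t) := by
  ext i
  refine Fin.cases ?_ (fun i => ?_) i <;> simp

theorem bdFun_pull {g : (Fin (k + 1) → W) → ℝ} (hg : ∀ t, g t ≠ 0 → InBall τ m t) :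
    bdFun (E.pull g) = E.pull (bdFun g) := by
  ext t
  by_cases ht : InBall σ m t
  · rw [E.pull_of_inBall _ ht, bdFun, bdFun,
      ← finsum_mem_univ, ← finsum_mem_univ (fun w => g (Fin.cons w (E.toFun ∘ t))),
      finsum_mem_inter_support_eq' _ _ {v | InBall σ m (Fin.cons v t : Fin (k + 1) → V)},
      finsum_mem_inter_support_eq' (fun w => g (Fin.cons w (E.toFun ∘ t))) _
        {w | InBall τ m (Fin.cons w (E.toFun ∘ t) : Fin (k + 1) → W)}]
    · have hmap : ∀ v, InBall σ m (Fin.cons v t : Fin (k + 1) → V) →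
          InBall τ m (Fin.cons (E.toFun v) (E.toFun ∘ t) : Fin (k + 1) → W) := fun v hv => by
        rw [← comp_cons]; exact E.inBall_map hv
      have hinv : ∀ w, InBall τ m (Fin.cons w (E.toFun ∘ t) : Fin (k + 1) → W) →
          InBall σ m (Fin.cons (E.invFun w) t : Fin (k + 1) → V) := fun w hw => by
        have := E.symm.inBall_map hw
        rwa [show E.symm.toFun = E.invFun from rfl, comp_cons, E.inv_comp ht] at this
      have hl : ∀ v, InBall σ m (Fin.cons v t : Fin (k + 1) → V) → E.invFun (E.toFun v) = v :=
        fun v hv => congrFun (E.inv_comp hv) 0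
      have hr : ∀ w, InBall τ m (Fin.cons w (E.toFun ∘ t) : Fin (k + 1) → W) →
          E.toFun (E.invFun w) = w := fun w hw => congrFun (E.symm.inv_comp hw) 0
      refine finsum_mem_eq_of_bijOn E.toFun ⟨hmap, fun v hv v' hv' h => ?_, fun w hw => ?_⟩ ?_
      · rw [← hl v hv, h, hl v' hv']
      · exact ⟨E.invFun w, hinv w hw, hr w hw⟩
      · intro v hv
        rw [E.pull_of_inBall _ hv, comp_cons]
    · intro w hw
      simp only [Set.mem_univ, true_iff]
      exact hg _ hw
    · intro v hv
      simp only [Set.mem_univ, true_iff]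
      by_contra hcon
      exact hv (E.pull_of_not_inBall _ hcon)
  · rw [E.pull_of_not_inBall _ ht, bdFun, ← finsum_zero (α := V)]
    refine finsum_congr fun v => E.pull_of_not_inBall _ fun hv => ht ?_
    have := hv.comp (Fin.succ_injective _)
    rwa [show (Fin.cons v t : Fin (k + 1) → V) ∘ Fin.succ = t by ext; simp] at this

end BallEquiv

/-! ### Approximation by forms supported near a given cell -/

open Classical in
/-- The restriction of a form to the cells at distance at most `r` from `σ`. -/
noncomputable def restrictNear (σ : X.Ridge) (r : ℕ) (f : X.L2Form d) : X.L2Form d :=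
  ⟨fun t => if verts t ∈ near σ r then f.val t else 0, fun t ht => by simp [f.eq_zero ht],
    fun p t => by
      simp only [verts_comp]
      split_ifs
      · exact f.comp_perm p t
      · simp,
    Summable.of_nonneg_of_le (fun t => mul_nonneg (X.wt_nonneg t) (sq_nonneg _))
      (fun t => by
        beta_reduce
        split_ifs
        · exact le_rfl
        · simpa using mul_nonneg (X.wt_nonneg t) (sq_nonneg (f.val t))) f.summable_sq⟩

open Classical in
theorem restrictNear_val (σ : X.Ridge) (r : ℕ) (f : X.L2Form d) (t : Fin d → V) :
    (restrictNear σ r f).val t = if verts t ∈ near σ r then f.val t else 0 := rfl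

theorem supportedNear_restrictNear (σ : X.Ridge) (r : ℕ) (f : X.L2Form d) :
    SupportedNear σ r (restrictNear σ r f).val := by
  classical
  intro t ht
  rw [restrictNear_val] at ht
  split_ifs at ht with h
  · refine ⟨?_, h⟩
    by_contra hcon
    exact ht (f.eq_zero fun h' => hcon h'.1)
  · exact absurd rfl ht

theorem tendsto_restrictNear (hX : X.IsRidgeConnected) (σ : X.Ridge) (f : X.L2Form d) :
    Tendsto (fun r => restrictNear σ r f) atTop (𝓝 f) := by
  classical
  rw [tendsto_iff_norm_sub_tendsto_zero]
  have hsq : Tendsto (fun r => ‖restrictNear σ r f - f‖ ^ 2) atTop (𝓝 0) := by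
    simp only [L2Form.norm_sq]
    rw [← mul_zero (d.factorial : ℝ)⁻¹]
    refine Tendsto.const_mul _ ?_
    rw [← tsum_zero (β := Fin d → V)]
    have hval : ∀ r t, (restrictNear σ r f - f).val t =
        if verts t ∈ near σ r then 0 else -f.val t := fun r t => by
      rw [sub_eq_add_neg, ← neg_one_smul ℝ f]
      simp only [L2Form.val_add, L2Form.val_smul, Pi.add_apply, Pi.smul_apply, restrictNear_val]
      split_ifs <;> simp
    refine tendsto_tsum_of_dominated_convergence f.summable_sq (fun t => ?_)
      (Eventually.of_forall fun r t => ?_)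
    · refine tendsto_const_nhds.congr' ?_
      by_cases ht : X.IsOrdering t
      · obtain ⟨j, hj⟩ := exists_mem_near hX σ ht.2 (card_verts ht.1)
        filter_upwards [eventually_ge_atTop j] with r hr
        rw [hval, if_pos (near_mono hr hj)]
        simp
      · refine Eventually.of_forall fun r => ?_
        simp [hval, f.eq_zero ht]
    · have h0 := mul_nonneg (X.wt_nonneg t) (sq_nonneg (f.val t))
      rw [hval]
      split_ifs
      · simpa using h0
      · rw [neg_sq, Real.norm_eq_abs, abs_of_nonneg h0]
  have := hsq.sqrt
  simpa [Real.sqrt_sq (norm_nonneg _)] using this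

end Transport

/-! ### Norms of pulled-back forms and of their images under the operators -/

section Norms

variable {V W : Type*}

namespace BallEquiv

section General

variable {d : ℕ} {X : DComplex V d} {Y : DComplex W d} {σ : X.Ridge} {τ : Y.Ridge} {m j : ℕ}
  (E : BallEquiv σ τ m) {f : X.L2Form d} {g : Y.L2Form d}

theorem norm_eq (hfg : f.val = E.pull g.val) (hg : SupportedNear τ j g.val) (hjm : j + 1 ≤ m) :
    ‖f‖ = ‖g‖ :=
  E.norm_eq_of_val_eq_pull hfg (hg.inBall (by omega))
    fun _ ht h => E.wt_map_of_supportedNear hg hjm ht h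

theorem coboundary_val_eq_pull (hfg : f.val = E.pull g.val) (hg : SupportedNear τ j g.val)
    (hjm : j + 1 ≤ m) (hX : X.DegreesBounded d) (hY : Y.DegreesBounded d) :
    (coboundary d hX f).val = E.pull (coboundary d hY g).val := by
  rw [coboundary_val, coboundary_val, hfg, E.cobFun_pull hg hjm]

theorem norm_coboundary_eq (hfg : f.val = E.pull g.val) (hg : SupportedNear τ j g.val)
    (hjm : j + 1 ≤ m) (hX : X.DegreesBounded d) (hY : Y.DegreesBounded d) :
    ‖coboundary d hX f‖ = ‖coboundary d hY g‖ :=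
  E.norm_eq_of_val_eq_pull (E.coboundary_val_eq_pull hfg hg hjm hX hY)
    (hg.inBall_of_cobFun_ne_zero hjm) fun _ ht _ => E.wt_map_of_ne (Nat.succ_ne_self d) ht

/-- One more layer of the ball is needed than for `δ`, since `Δ⁺ f` is supported one step further. -/
theorem norm_upLaplacian_eq (hfg : f.val = E.pull g.val) (hg : SupportedNear τ j g.val)
    (hjm : j + 2 ≤ m) (hX : X.DegreesBounded d) (hY : Y.DegreesBounded d) :
    ‖X.upLaplacian d hX f‖ = ‖Y.upLaplacian d hY g‖ := by
  refine E.norm_eq (j := j + 1) ?_ hg.bdFun_cobFun hjm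
  change bdFun (coboundary d hX f).val = E.pull (bdFun (coboundary d hY g).val)
  rw [E.coboundary_val_eq_pull hfg hg (by omega) hX hY]
  exact E.bdFun_pull (hg.inBall_of_cobFun_ne_zero (by omega))

end General

theorem norm_boundary_eq {e : ℕ} {X : DComplex V (e + 1)} {Y : DComplex W (e + 1)} {σ : X.Ridge}
    {τ : Y.Ridge} {m j : ℕ} (E : BallEquiv σ τ m) {f : X.L2Form (e + 1)} {g : Y.L2Form (e + 1)}
    (hfg : f.val = E.pull g.val) (hg : SupportedNear τ j g.val)
    (hjm : j ≤ m) (hX : X.DegreesBounded e) (hY : Y.DegreesBounded e) :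
    ‖boundary e hX f‖ = ‖boundary e hY g‖ := by
  have hb : ∀ t : Fin e → W, bdFun g.val t ≠ 0 → InBall τ m t := by
    intro t ht
    obtain ⟨w, hw⟩ : ∃ w, g.val (Fin.cons w t) ≠ 0 := by
      by_contra! hall
      exact ht (by simp [bdFun, hall])
    have := (hg.inBall hjm _ hw).comp (Fin.succ_injective _)
    rwa [show (Fin.cons w t : Fin (e + 1) → W) ∘ Fin.succ = t by ext; simp] at this
  refine E.norm_eq_of_val_eq_pull ?_ hb fun _ ht _ => E.wt_map_of_ne (Nat.succ_ne_self e).symm ht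
  rw [boundary_val, boundary_val, hfg, E.bdFun_pull (hg.inBall hjm)]

end BallEquiv

end Norms

/-! ### Semicontinuity of the gap under convergence -/

section Comparison

variable {U : ℕ → Type*} {W : Type*}

/-- Any number above a positive point of the spectrum of the limit eventually exceeds the gaps. -/
theorem eventually_spectralGap_lt_of_mem_cycleSpectrum {d : ℕ} {X : ∀ n, DComplex (U n) d}
    {Y : DComplex W d} (hY : Y.IsRidgeConnected) {σ : ∀ n, (X n).Ridge} {τ : Y.Ridge}
    (hconv : ∀ r : ℕ, ∀ᶠ n in atTop, ∃ m, r ≤ m ∧ Nonempty (BallEquiv (σ n) τ m)) {μ a : ℝ}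
    (hμ : μ ∈ Y.cycleSpectrum d Y.degreesBounded) (hμ0 : 0 < μ) (hμa : μ < a) :
    ∀ᶠ n in atTop, (X n).spectralGap < a := by
  obtain ⟨f, hf⟩ := exists_norm_upLaplacian_lt Y.degreesBounded hμ hμ0 hμa
  -- The strict inequality persists for a form supported near `τ`.
  obtain ⟨r, hr⟩ : ∃ r, ‖Y.upLaplacian d Y.degreesBounded (restrictNear τ r f)‖ ^ 2 <
      a * ‖coboundary d Y.degreesBounded (restrictNear τ r f)‖ ^ 2 := by
    have hlim := tendsto_restrictNear hY τ f
    have h1 := ((Y.upLaplacian d Y.degreesBounded).continuous.tendsto f).comp hlim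
    have h2 := ((coboundary d Y.degreesBounded).continuous.tendsto f).comp hlim
    exact ((h1.norm.pow 2).eventually_lt ((h2.norm.pow 2).const_mul a) hf).exists
  filter_upwards [hconv (r + 2)] with n hn
  obtain ⟨m, hm, ⟨E⟩⟩ := hn
  have hsupp := supportedNear_restrictNear τ r f
  obtain ⟨g, hg⟩ := E.exists_form_val_eq_pull _ hsupp (by omega)
  rw [← E.norm_upLaplacian_eq hg hsupp hm (X n).degreesBounded,
    ← E.norm_coboundary_eq hg hsupp (by omega) (X n).degreesBounded] at hr
  by_contra hcon
  exact absurd (mul_norm_coboundary_le (X n).degreesBounded (hμ0.trans hμa) (not_lt.mp hcon) g)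
    (not_le.mpr hr)

variable {e : ℕ} {X : ∀ n, DComplex (U n) (e + 1)} {Y : DComplex W (e + 1)}

/-- A common bound for the degrees of the cells two dimensions below the top passes to the limit: the
cells containing a given one lie in some ball, by connectedness. -/
theorem degreesLE_of_convergesTo (hY : Y.IsRidgeConnected) {σ : ∀ n, (X n).Ridge} {τ : Y.Ridge}
    (hconv : ∀ r : ℕ, ∀ᶠ n in atTop, ∃ m, r ≤ m ∧ Nonempty (BallEquiv (σ n) τ m)) {K : ℕ}
    (hK : ∀ n, (X n).DegreesLE e K) : Y.DegreesLE e K := by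
  classical
  intro s hs hsc
  by_contra hlt
  rw [not_le, degree] at hlt
  obtain ⟨T, hTS, hT⟩ := Set.exists_subset_encard_eq (Order.add_one_le_of_lt hlt)
  have hfin : T.Finite := Set.finite_of_encard_eq_coe (k := K + 1) (by rw [hT]; push_cast; rfl)
  have hnear : ∀ᶠ r in atTop, ∀ t ∈ T, t ∈ near τ r := by
    rw [Filter.eventually_all_finite hfin]
    intro t ht
    obtain ⟨h1, -, h2⟩ := hTS ht
    obtain ⟨j, hj⟩ := exists_mem_near hY τ h1 (by omega)
    filter_upwards [eventually_ge_atTop j] with r hr using near_mono hr hj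
  obtain ⟨r, hr⟩ := hnear.exists
  obtain ⟨n, m, hm, ⟨E⟩⟩ := (hconv r).exists
  have hball : ∀ t ∈ T, t ∈ Y.ball τ m := fun t ht => mem_ball_of_mem_near (near_mono hm (hr t ht))
  obtain ⟨t₀, ht₀⟩ : T.Nonempty := by
    rw [← Set.encard_ne_zero, hT]; simp
  have hsb : s ∈ Y.ball τ m := mem_ball_of_subset (hball t₀ ht₀) (hTS ht₀).2.1
  have hcard : (s.image E.symm.toFun).card = e := by rw [E.symm.card_image hsb, hsc]
  have hle : T.encard ≤ (X n).degree (s.image E.symm.toFun) := by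
    refine Set.encard_le_encard_of_injOn (f := Finset.image E.symm.toFun) ?_ ?_
    · intro t ht
      obtain ⟨-, hst, htc⟩ := hTS ht
      refine ⟨ball_subset_cells _ m (E.symm.image_mem t (hball t ht)),
        Finset.image_subset_image hst, ?_⟩
      rw [E.symm.card_image (hball t ht), hcard, htc, hsc]
    · intro t ht t' ht' h
      rw [← E.symm.image_inv_image (hball t ht), h, E.symm.image_inv_image (hball t' ht')]
  have h1 := hle.trans (hK n _ (ball_subset_cells _ m (E.symm.image_mem s hsb)) hcard)
  rw [hT] at h1
  have h2 : K + 1 ≤ K := by exact_mod_cast h1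
  omega

/-- When the skeletons expand, any number above the gap of the limit eventually exceeds the gaps. -/
theorem eventually_spectralGap_lt_of_skeletonsExpand (hY : Y.IsRidgeConnected)
    {σ : ∀ n, (X n).Ridge} {τ : Y.Ridge}
    (hconv : ∀ r : ℕ, ∀ᶠ n in atTop, ∃ m, r ≤ m ∧ Nonempty (BallEquiv (σ n) τ m)) {a : ℝ}
    (hexp : SkeletonsExpand X) (ha : Y.spectralGap < a) :
    ∀ᶠ n in atTop, (X n).spectralGap < a := by
  obtain ⟨K, hK, c, hc, hgap⟩ := hexp
  replace hK : ∀ n, (X n).DegreesLE e K := hK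
  replace hgap : ∀ n, c ≤ (X n).gap e ⟨K, hK n⟩ := hgap
  have hYK : Y.DegreesBounded e := ⟨K, degreesLE_of_convergesTo hY hconv hK⟩
  have ha0 : 0 < a := (gap_nonneg Y.degreesBounded).trans_lt ha
  obtain ⟨z, hz, hza⟩ := exists_cycle_norm_coboundary_lt Y.degreesBounded
    (cycles_ne_bot Y.degreesBounded) ha
  have hz' : c⁻¹ * ‖boundary e hYK z‖ ^ 2 + a⁻¹ * ‖coboundary (e + 1) Y.degreesBounded z‖ ^ 2 <
      ‖z‖ ^ 2 := by
    rw [boundary_eq_zero_of_mem_cycles hYK hz, norm_zero, inv_mul_eq_div a, zero_pow two_ne_zero,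
      mul_zero, zero_add, div_lt_iff₀ ha0, mul_comm]
    exact hza
  -- The strict inequality persists for a form supported near `τ`.
  obtain ⟨r, hr⟩ : ∃ r, c⁻¹ * ‖boundary e hYK (restrictNear τ r z)‖ ^ 2 +
      a⁻¹ * ‖coboundary (e + 1) Y.degreesBounded (restrictNear τ r z)‖ ^ 2 <
      ‖restrictNear τ r z‖ ^ 2 := by
    have hlim := tendsto_restrictNear hY τ z
    have h1 := ((boundary e hYK).continuous.tendsto z).comp hlim
    have h2 := ((coboundary (e + 1) Y.degreesBounded).continuous.tendsto z).comp hlim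
    exact ((((h1.norm.pow 2).const_mul c⁻¹).add ((h2.norm.pow 2).const_mul a⁻¹)).eventually_lt
      (hlim.norm.pow 2) hz').exists
  filter_upwards [hconv (r + 1)] with n hn
  obtain ⟨m, hm, ⟨E⟩⟩ := hn
  have hsupp := supportedNear_restrictNear τ r z
  obtain ⟨g, hg⟩ := E.exists_form_val_eq_pull _ hsupp hm
  rw [← E.norm_eq hg hsupp hm, ← E.norm_coboundary_eq hg hsupp hm (X n).degreesBounded,
    ← E.norm_boundary_eq hg hsupp (by omega) ⟨K, hK n⟩] at hr
  by_contra hcon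
  exact absurd (norm_sq_le_boundary_add_coboundary ⟨K, hK n⟩ (X n).degreesBounded ha0 hc (hgap n)
    (not_lt.mp hcon) g) (not_le.mpr hr)

end Comparison

end DComplex

theorem theorem3p11 {d : ℕ} (hd : 1 ≤ d) {V : ℕ → Type*} {W : Type*}
    (X : ∀ n, DComplex (V n) d) (Y : DComplex W d)
    (hX : ∀ n, (X n).IsRidgeConnected) (hY : Y.IsRidgeConnected)
    (hconv : DComplex.ConvergesTo X Y)
    (hcond : (0 : ℝ) ∉ Y.cycleSpectrum d Y.degreesBounded ∨
      ((0 : ℝ) ∈ Y.cycleSpectrum d Y.degreesBounded ∧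
        AccPt (0 : ℝ) (𝓟 (Y.cycleSpectrum d Y.degreesBounded))) ∨
      DComplex.SkeletonsExpand X) :
    liminf (fun n => (X n).spectralGap) atTop ≤ Y.spectralGap := by
  obtain ⟨σ, τ, hball⟩ := hconv.eventually_ballEquiv hd
  refine le_of_forall_gt_imp_ge_of_dense fun a ha => ?_
  have hnn : ∀ n, 0 ≤ (X n).spectralGap := fun n => DComplex.gap_nonneg _
  suffices h : ∀ᶠ n in atTop, (X n).spectralGap < a from
    liminf_le_of_frequently_le (h.mono fun _ hn => hn.le).frequently
      ⟨0, eventually_map.mpr (Eventually.of_forall hnn)⟩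
  have hgap := DComplex.gap_mem_cycleSpectrum Y.degreesBounded
    (DComplex.cycles_ne_bot Y.degreesBounded)
  have hgap0 := DComplex.gap_nonneg Y.degreesBounded
  rcases hcond with h0 | ⟨-, hacc⟩ | hexp
  · have hne : Y.gap d Y.degreesBounded ≠ 0 := fun h => h0 (h ▸ hgap)
    exact DComplex.eventually_spectralGap_lt_of_mem_cycleSpectrum hY hball hgap
      (lt_of_le_of_ne hgap0 hne.symm) ha
  -- Near an accumulation point `0` there are positive points of the spectrum below `a`.
  · obtain ⟨μ, ⟨hμa, hμ⟩, hμ0⟩ := accPt_iff_nhds.mp hacc _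
      (Iio_mem_nhds (hgap0.trans_lt ha))
    exact DComplex.eventually_spectralGap_lt_of_mem_cycleSpectrum hY hball hμ
      (lt_of_le_of_ne (DComplex.nonneg_of_mem_cycleSpectrum _ hμ) hμ0.symm) hμa
  · obtain ⟨e, rfl⟩ : ∃ e, d = e + 1 := ⟨d - 1, by omega⟩
    exact DComplex.eventually_spectralGap_lt_of_skeletonsExpand hY hball hexp ha
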